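/- Let $A=\{0,1\}$ and let $n\ge 1$. Write $nA^*$ for the monoid of $n$-tuples of finite bit strings with coordinatewise concatenation, and $nA^\omega$ for the set of $n$-tuples of infinite bit strings. For $u,v\in nA^*$ write $u\le_{\rm init} v$ if $v=ux$ for some $x\in nA^*$; a set $P\subseteq nA^*$ is a joinless code if no two distinct elements of $P$ have a join (least common upper bound) for $\le_{\rm init}$, and it is maximal if it is $\subseteq$-maximal among the joinless codes. Let $n\mathcal{RI}^{\sf fin}$ be the set of injective partial functions $f:nA^*\to nA^*$ such that, for every $x\in{\rm Dom}(f)$ and $w\in nA^*$, $f(xw)$ is defined and equal to $f(x)w$, and such that the sets ${\rm domC}(f)$ and ${\rm imC}(f)$ of $\le_{\rm init}$-minimal elements of ${\rm Dom}(f)$ and of ${\rm Im}(f)$ are finite maximal joinless codes. Every $f\in n\mathcal{RI}^{\sf fin}$ induces the permutation $f^{(\omega)}$ of $nA^\omega$ given by $f^{(\omega)}(pu)=f(p)u$ for $p\in{\rm domC}(f)$, $u\in nA^\omega$, and the Brin-Thompson group $nV$ is the group of all these permutations. Let $\ell(f)$ be the maximum length of a coordinate of an element of ${\rm domC}(f)\cup{\rm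 imC}(f)$. A set $T\subseteq\Sigma^*$ ($\Sigma$ a finite alphabet) is in ${\sf coNP}$ if there are $m\ge1$, a predicate $R\subseteq mA^*\times\Sigma^*$ decidable in deterministic polynomial time, and a polynomial $p$ such that $T=\{w\in\Sigma^*:\ R(x,w)\text{ holds for all }x\in mA^*\text{ whose coordinates all have length}\le p(|w|)\}$. Let $\Gamma$ be a finite generating set of $nV$, let $\Gamma^{\pm1}=\Gamma\cup\Gamma^{-1}$, and let $|w|$ be the length of a word $w\in(\Gamma^{\pm1})^*$. Then: (1) The word problem of $nV$ over $\Gamma$, i.e. the set of words $w\in(\Gamma^{\pm1})^*$ whose value in $nV$ is $1$, is in ${\sf coNP}$. (2) For each $\gamma\in\Gamma^{\pm1}$ choose any $f_\gamma\in n\mathcal{RI}^{\sf fin}$ with $f_\gamma^{(\omega)}=\gamma$; for $w=\gamma_t\cdots\gamma_1\in(\Gamma^{\pm1})^*$ let $f_w=f_{\gamma_t}\circ\cdots\circ f_{\gamma_1}$ (the identity of $nA^*$ if $w$ is empty), and let $c_\Gamma=\max\{\ell(f_\gamma):\gamma\in\Gamma^{\pm1}\}$. Then: (a) for every word $w$: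 $w=1$ in $nV$ if and only if $f_w(x)=x$ for every $x\in nA^*$ all of whose coordinates have length $c_\Gamma|w|$; (b) for every word $w=\gamma_t\cdots\gamma_1$, every such $x$, and every $0\le j\le t$, the tuple $y^{(j)}=f_{\gamma_j}(\cdots f_{\gamma_1}(x)\cdots)$ is defined, and its coordinates have length at most $2c_\Gamma|w|$; (c) the partial map $(x,w)\mapsto f_w(x)$ on $nA^*\times(\Gamma^{\pm1})^*$ (with definedness as part of the output) is computable in deterministic polynomial time, and the predicate $R(x,w)$ that says "if all coordinates of $x$ have length $c_\Gamma|w|$ then $f_w(x)=x$" is decidable in deterministic polynomial time. -/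

import Mathlib

namespace BrinThompson

/-! ### Tuples of strings -/

/-- The monoid `nA*` with `A = {0,1}`: `n`-tuples of finite bit strings. -/
abbrev Tup (n : ℕ) : Type := Fin n → List Bool

/-- The space `nA^ω` with `A = {0,1}`: `n`-tuples of infinite bit strings. -/
abbrev Pt (n : ℕ) : Type := Fin n → Stream' Bool

/-- The product in `nA*`: coordinatewise concatenation. -/
def cat {n : ℕ} (u v : Tup n) : Tup n := fun i => u i ++ v i

/-- Coordinatewise concatenation of a tuple of finite strings and a tuple of infinite strings. -/
def catInf {n : ℕ} (u : Tup n) (s : Pt n) : Pt n := fun i => u i ++ₛ s i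

/-- The initial factor order of `nA*`. -/
def InitLE {n : ℕ} (u v : Tup n) : Prop := ∃ x, cat u x = v

/-- `z` is the join of `u` and `v`, i.e. the least common upper bound in the initial factor
order. -/
def IsJoin {n : ℕ} (u v z : Tup n) : Prop :=
  InitLE u z ∧ InitLE v z ∧ ∀ z', InitLE u z' → InitLE v z' → InitLE z z'

/-- Joinless codes: no two different elements have a join. -/
def Joinless {n : ℕ} (P : Set (Tup n)) : Prop :=
  ∀ u ∈ P, ∀ v ∈ P, u ≠ v → ¬ ∃ z, IsJoin u v z

/-- The initial factor code that generates a right ideal `R` of `nA*`: the set of those elements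
of `R` that are minimal in the initial factor order. -/
def code {n : ℕ} (R : Set (Tup n)) : Set (Tup n) :=
  {p | p ∈ R ∧ ∀ q ∈ R, InitLE q p → q = p}

/-! ### Injective right ideal morphisms

An injective partial function is a `PEquiv`. -/

/-- The domain code of an injective partial function. -/
def domC {n : ℕ} (f : Tup n ≃. Tup n) : Set (Tup n) := code {x | ∃ y, f x = some y}

/-- The image code of an injective partial function. -/
def imC {n : ℕ} (f : Tup n ≃. Tup n) : Set (Tup n) := code {y | ∃ x, f x = some y}

/-- Membership in the monoid `nRI^fin`: injective right ideal morphisms of `nA*` whose domain code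
and image code are finite maximal joinless codes. -/
structure IsRIFin {n : ℕ} (f : Tup n ≃. Tup n) : Prop where
  map_cat : ∀ x y w, f x = some y → f (cat x w) = some (cat y w)
  finite_domC : (domC f).Finite
  maximal_domC : Maximal Joinless (domC f)
  finite_imC : (imC f).Finite
  maximal_imC : Maximal Joinless (imC f)

/-- `σ` is the permutation `f^(ω)` of `nA^ω` induced by `f`: `f^(ω)(p u) = f(p) u` for every `p`
in the domain code of `f` and every `u` in `nA^ω`. -/
def Induces {n : ℕ} (f : Tup n ≃. Tup n) (σ : Equiv.Perm (Pt n)) : Prop :=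
  ∀ p ∈ domC f, ∀ q, f p = some q → ∀ u, σ (catInf p u) = catInf q u

/-- The maximum length `ℓ(f)` of the coordinates of the elements of `domC f ∪ imC f`. -/
noncomputable def ell {n : ℕ} (f : Tup n ≃. Tup n) : ℕ :=
  sSup {k | ∃ z ∈ domC f ∪ imC f, ∃ i, k = (z i).length}

/-! ### Helper facts for the definition of the group -/

theorem cat_assoc {n : ℕ} (u v w : Tup n) : cat (cat u v) w = cat u (cat v w) := by
  funext i; simp [cat]

theorem catInf_cat {n : ℕ} (u v : Tup n) (s : Pt n) :
    catInf (cat u v) s = catInf u (catInf v s) := by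
  funext i; simp [cat, catInf, Stream'.append_append_stream]

theorem prefix_of_append_eq {a b : List Bool} {s t : Stream' Bool} (h : a ++ₛ s = b ++ₛ t)
    (hl : a.length ≤ b.length) : a <+: b := by
  have h1 := congrArg (Stream'.take a.length) h
  have h2 : Stream'.take a.length (a ++ₛ s) = a := by
    rw [Stream'.take_append_of_le_length _ _ _ le_rfl, List.take_length]
  have h3 : Stream'.take a.length (b ++ₛ t) = b.take a.length :=
    Stream'.take_append_of_le_length _ _ _ hl
  rw [h2, h3] at h1
  rw [h1]
  exact List.take_prefix _ _

theorem initLE_iff {n : ℕ} {u v : Tup n} : InitLE u v ↔ ∀ i, u i <+: v i := by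
  constructor
  · rintro ⟨x, rfl⟩ i
    exact ⟨x i, rfl⟩
  · intro h
    choose x hx using h
    exact ⟨x, funext hx⟩

theorem exists_join_iff {n : ℕ} {u v : Tup n} :
    (∃ z, IsJoin u v z) ↔ ∃ s t, catInf u s = catInf v t := by
  constructor
  · rintro ⟨z, ⟨x, hx⟩, ⟨y, hy⟩, -⟩
    refine ⟨catInf x fun _ => Stream'.const false, catInf y fun _ => Stream'.const false, ?_⟩
    rw [← catInf_cat, ← catInf_cat, hx, hy]
  · rintro ⟨s, t, h⟩
    refine ⟨fun i => if (u i).length ≤ (v i).length then v i else u i, ?_, ?_, ?_⟩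
    · refine initLE_iff.2 fun i => ?_
      split_ifs with hl
      · exact prefix_of_append_eq (congrFun h i) hl
      · exact List.prefix_rfl
    · refine initLE_iff.2 fun i => ?_
      split_ifs with hl
      · exact List.prefix_rfl
      · exact prefix_of_append_eq (congrFun h i).symm (by omega)
    · intro z' hu hv
      refine initLE_iff.2 fun i => ?_
      split_ifs
      · exact initLE_iff.1 hv i
      · exact initLE_iff.1 hu i

theorem catInf_left_inj {n : ℕ} {u v : Tup n} (h : ∀ s, catInf u s = catInf v s) : u = v := by
  have key : ∀ a b : List Bool, (∀ s, a ++ₛ s = b ++ₛ s) → a.length ≤ b.length → a = b := by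
    intro a b hab hl
    obtain ⟨c, rfl⟩ := prefix_of_append_eq (hab (Stream'.const false)) hl
    cases c with
    | nil => simp
    | cons d c =>
      exfalso
      have h1 := congrArg (Stream'.drop a.length) (hab (Stream'.const (!d)))
      rw [Stream'.append_append_stream, Stream'.drop_append_stream,
        Stream'.drop_append_stream] at h1
      have h2 := congrArg Stream'.head h1
      change (!d) = d at h2
      cases d <;> simp at h2
  funext i
  have hi : ∀ s, u i ++ₛ s = v i ++ₛ s := fun s => congrFun (h fun _ => s) i
  rcases le_total (u i).length (v i).length with hl | hl
  · exact key _ _ hi hl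
  · exact (key _ _ (fun s => (hi s).symm) hl).symm

theorem catInf_inj_of_length {n : ℕ} {u v : Tup n} {s t : Pt n} (h : catInf u s = catInf v t)
    (hl : ∀ i, (u i).length = (v i).length) : u = v := by
  funext i
  exact (prefix_of_append_eq (congrFun h i) (hl i).le).eq_of_length (hl i)

theorem exists_catInf {n : ℕ} (N : ℕ) (w : Pt n) :
    ∃ (x : Tup n) (s : Pt n), (∀ i, (x i).length = N) ∧ catInf x s = w :=
  ⟨fun i => (w i).take N, fun i => (w i).drop N, fun _ => Stream'.length_take _ _,
    funext fun _ => Stream'.append_take_drop _ _⟩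

theorem exists_cat {n : ℕ} (N : ℕ) (x : Tup n) (hx : ∀ i, N ≤ (x i).length) :
    ∃ u v : Tup n, (∀ i, (u i).length = N) ∧ cat u v = x :=
  ⟨fun i => (x i).take N, fun i => (x i).drop N, fun i => by simp [hx i],
    funext fun i => List.take_append_drop _ _⟩

theorem finite_length_eq (n N : ℕ) : {x : Tup n | ∀ i, (x i).length = N}.Finite := by
  have := Set.Finite.pi (t := fun _ : Fin n => {l : List Bool | l.length = N})
    fun _ => List.finite_length_eq Bool N
  refine this.subset fun x hx => ?_
  simpa using hx

theorem exists_length_le {n : ℕ} {P : Set (Tup n)} (hP : P.Finite) :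
    ∃ N, ∀ p ∈ P, ∀ i, (p i).length ≤ N := by
  obtain ⟨N, hN⟩ := (hP.image fun p => ∑ i, (p i).length).bddAbove
  refine ⟨N, fun p hp i => le_trans ?_ (hN ⟨p, hp, rfl⟩)⟩
  exact Finset.single_le_sum (f := fun i => (p i).length) (fun _ _ => Nat.zero_le _)
    (Finset.mem_univ i)

/-- A joinless code whose cylinders cover `nA^ω` is maximal. -/
theorem maximal_of_cover {n : ℕ} {P : Set (Tup n)} (hP : Joinless P)
    (hc : ∀ w, ∃ p ∈ P, ∃ s, catInf p s = w) : Maximal Joinless P := by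
  refine ⟨hP, fun T hT hPT t ht => ?_⟩
  obtain ⟨p, hp, s, hs⟩ := hc (catInf t fun _ => Stream'.const false)
  by_cases h : p = t
  · exact h ▸ hp
  · exact absurd (exists_join_iff.2 ⟨_, _, hs⟩) (hT p (hPT hp) t ht h)

/-- The permutation acts on all sufficiently long tuples by replacing initial factors. -/
def IsLocal {n : ℕ} (σ : Equiv.Perm (Pt n)) : Prop :=
  ∃ N : ℕ, ∀ x : Tup n, (∀ i, (x i).length = N) → ∃ y, ∀ s, σ (catInf x s) = catInf y s

theorem isLocal_of_induces {n : ℕ} {f : Tup n ≃. Tup n} {σ : Equiv.Perm (Pt n)}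
    (hf : IsRIFin f) (h : Induces f σ) : IsLocal σ := by
  obtain ⟨N, hN⟩ := exists_length_le hf.finite_domC
  refine ⟨N, fun x hx => ?_⟩
  have h1 : ∃ p ∈ domC f, ∃ z, IsJoin p x z := by
    by_contra hcon
    push Not at hcon
    have hself : ∃ z, IsJoin x x z :=
      exists_join_iff.2 ⟨fun _ => Stream'.const false, _, rfl⟩
    have hj : Joinless (insert x (domC f)) := by
      rintro u (rfl | hu) v (rfl | hv) huv
      · exact absurd rfl huv
      · rintro ⟨z, h1, h2, h3⟩
        exact hcon v hv z ⟨h2, h1, fun z' a b => h3 z' b a⟩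
      · rintro ⟨z, hz⟩
        exact hcon u hu z hz
      · exact hf.maximal_domC.prop u hu v hv huv
    have hx' := hf.maximal_domC.2 hj (Set.subset_insert _ _) (Set.mem_insert _ _)
    exact hcon x hx' _ hself.choose_spec
  obtain ⟨p, hp, z, hpz, hxz, -⟩ := h1
  have hpx : InitLE p x := initLE_iff.2 fun i =>
    List.prefix_of_prefix_length_le (initLE_iff.1 hpz i) (initLE_iff.1 hxz i)
      ((hN p hp i).trans (hx i).ge)
  obtain ⟨v, rfl⟩ := hpx
  obtain ⟨q, hq⟩ := hp.1
  refine ⟨cat q v, fun s => ?_⟩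
  rw [catInf_cat, catInf_cat]
  exact h p hp q hq _

theorem exists_induces_of_isLocal {n : ℕ} {σ : Equiv.Perm (Pt n)} (h : IsLocal σ) :
    ∃ f : Tup n ≃. Tup n, IsRIFin f ∧ Induces f σ := by
  classical
  obtain ⟨N, hN⟩ := h
  let r : Tup n → Tup n → Prop := fun x y =>
    (∀ i, N ≤ (x i).length) ∧ ∀ s, σ (catInf x s) = catInf y s
  have hr1 : ∀ {x y y'}, r x y → r x y' → y = y' := fun h h' =>
    catInf_left_inj fun s => (h.2 s).symm.trans (h'.2 s)
  have hr2 : ∀ {x x' y}, r x y → r x' y → x = x' := fun h h' =>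
    catInf_left_inj fun s => σ.injective ((h.2 s).trans (h'.2 s).symm)
  have hf1 : ∀ x y, (if h : ∃ y, r x y then some h.choose else none) = some y ↔ r x y := by
    intro x y
    constructor
    · intro h
      split_ifs at h with h'
      cases h
      exact h'.choose_spec
    · intro h
      have h' : ∃ y, r x y := ⟨y, h⟩
      rw [dif_pos h', hr1 h'.choose_spec h]
  have hf2 : ∀ x y, (if h : ∃ x, r x y then some h.choose else none) = some x ↔ r x y := by
    intro x y
    constructor
    · intro h
      split_ifs at h with h'
      cases h
      exact h'.choose_spec
    · intro h
      have h' : ∃ x, r x y := ⟨x, h⟩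
      rw [dif_pos h', hr2 h'.choose_spec h]
  let f : Tup n ≃. Tup n :=
    { toFun := fun x => if h : ∃ y, r x y then some h.choose else none
      invFun := fun y => if h : ∃ x, r x y then some h.choose else none
      inv := fun x y => (hf2 x y).trans (hf1 x y).symm }
  have hf : ∀ x y, f x = some y ↔ r x y := hf1
  have hrcat : ∀ x y w, r x y → r (cat x w) (cat y w) := by
    intro x y w h
    refine ⟨fun i => (h.1 i).trans (by simp [cat]), fun s => ?_⟩
    rw [catInf_cat, catInf_cat]
    exact h.2 _
  have hrN : ∀ x : Tup n, (∀ i, (x i).length = N) → ∃ y, r x y := by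
    intro x hx
    obtain ⟨y, hy⟩ := hN x hx
    exact ⟨y, fun i => (hx i).ge, hy⟩
  have hnil : ∀ u v : Tup n, (∀ i, ((cat u v) i).length = N) → (∀ i, N ≤ (u i).length) →
      u = cat u v := by
    intro u v h1 h2
    funext i
    have h3 := h1 i
    have h4 := h2 i
    simp only [cat, List.length_append] at h3
    have h5 : v i = [] := List.eq_nil_of_length_eq_zero (by omega)
    simp [cat, h5]
  have hdom : domC f = {x | ∀ i, (x i).length = N} := by
    ext x
    constructor
    · rintro ⟨⟨y, hy⟩, hmin⟩
      rw [hf] at hy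
      obtain ⟨u, v, hu, rfl⟩ := exists_cat N x hy.1
      obtain ⟨z, hz⟩ := hrN u hu
      have := hmin u ⟨z, (hf _ _).2 hz⟩ ⟨v, rfl⟩
      rw [← this]
      exact hu
    · intro hx
      obtain ⟨y, hy⟩ := hrN x hx
      refine ⟨⟨y, (hf _ _).2 hy⟩, ?_⟩
      rintro q ⟨z, hz⟩ ⟨v, rfl⟩
      exact hnil _ _ hx ((hf _ _).1 hz).1
  have him : imC f = {y | ∃ x, (∀ i, (x i).length = N) ∧ r x y} := by
    ext y
    constructor
    · rintro ⟨⟨x, hx⟩, hmin⟩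
      rw [hf] at hx
      obtain ⟨u, v, hu, rfl⟩ := exists_cat N x hx.1
      obtain ⟨z, hz⟩ := hrN u hu
      have hy : y = cat z v := hr1 hx (hrcat _ _ _ hz)
      have := hmin z ⟨u, (hf _ _).2 hz⟩ ⟨v, hy.symm⟩
      exact ⟨u, hu, this ▸ hz⟩
    · rintro ⟨x, hx, hxy⟩
      refine ⟨⟨x, (hf _ _).2 hxy⟩, ?_⟩
      rintro q ⟨z, hz⟩ ⟨v, rfl⟩
      rw [hf] at hz
      have hxz : x = cat z v := hr2 hxy (hrcat _ _ _ hz)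
      subst hxz
      have h1 := hnil _ _ hx hz.1
      rw [← h1] at hxy
      exact hr1 hz hxy
  refine ⟨f, ⟨?_, ?_, ?_, ?_, ?_⟩, ?_⟩
  · intro x y w h
    exact (hf _ _).2 (hrcat _ _ _ ((hf _ _).1 h))
  · rw [hdom]; exact finite_length_eq n N
  · rw [hdom]
    refine maximal_of_cover ?_ ?_
    · intro u hu v hv huv hj
      obtain ⟨s, t, hst⟩ := exists_join_iff.1 hj
      exact huv (catInf_inj_of_length hst fun i => (hu i).trans (hv i).symm)
    · intro w
      obtain ⟨x, s, hx, hs⟩ := exists_catInf N w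
      exact ⟨x, hx, s, hs⟩
  · rw [him]
    choose! g hg using hrN
    refine ((finite_length_eq n N).image g).subset ?_
    rintro y ⟨x, hx, hxy⟩
    exact ⟨x, hx, hr1 (hg x hx) hxy⟩
  · rw [him]
    refine maximal_of_cover ?_ ?_
    · rintro u ⟨x, hx, hxu⟩ v ⟨y, hy, hyv⟩ huv hj
      obtain ⟨s, t, hst⟩ := exists_join_iff.1 hj
      rw [← hxu.2, ← hyv.2] at hst
      have hxy := catInf_inj_of_length (σ.injective hst) fun i => (hx i).trans (hy i).symm
      subst hxy
      exact huv (hr1 hxu hyv)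
    · intro w
      obtain ⟨x, s, hx, hs⟩ := exists_catInf N (σ.symm w)
      obtain ⟨y, hy⟩ := hrN x hx
      exact ⟨y, ⟨x, hx, hy⟩, s, by rw [← hy.2, hs, Equiv.apply_symm_apply]⟩
  · intro p _ q hq
    exact ((hf _ _).1 hq).2

theorem IsLocal.one {n : ℕ} : IsLocal (1 : Equiv.Perm (Pt n)) :=
  ⟨0, fun x _ => ⟨x, fun _ => rfl⟩⟩

theorem IsLocal.mul {n : ℕ} {σ τ : Equiv.Perm (Pt n)} (hσ : IsLocal σ) (hτ : IsLocal τ) :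
    IsLocal (σ * τ) := by
  obtain ⟨N, hN⟩ := hσ
  obtain ⟨M, hM⟩ := hτ
  refine ⟨M + N, fun x hx => ?_⟩
  obtain ⟨u, v, hu, rfl⟩ := exists_cat M x fun i => by rw [hx i]; omega
  obtain ⟨y, hy⟩ := hM u hu
  have hlen : ∀ i, N ≤ (cat y v i).length := fun i => by
    have h1 := hx i
    have h2 := hu i
    simp only [cat, List.length_append] at h1 ⊢
    omega
  obtain ⟨a, b, ha, hab⟩ := exists_cat N (cat y v) hlen
  obtain ⟨z, hz⟩ := hN a ha
  refine ⟨cat z b, fun s => ?_⟩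
  rw [Equiv.Perm.mul_apply, catInf_cat, hy, ← catInf_cat, ← hab, catInf_cat, hz, ← catInf_cat]

theorem IsLocal.inv {n : ℕ} {σ : Equiv.Perm (Pt n)} (hσ : IsLocal σ) : IsLocal σ⁻¹ := by
  obtain ⟨N, hN⟩ := hσ
  choose! g hg using hN
  obtain ⟨M, hM⟩ := exists_length_le ((finite_length_eq n N).image g)
  refine ⟨M, fun z hz => ?_⟩
  obtain ⟨x, s, hx, hs⟩ := exists_catInf N (σ⁻¹ (catInf z fun _ => Stream'.const false))
  have h1 : catInf (g x) s = catInf z fun _ => Stream'.const false := by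
    rw [← hg x hx, hs]; exact σ.apply_symm_apply _
  obtain ⟨v, hv⟩ : InitLE (g x) z := initLE_iff.2 fun i =>
    prefix_of_append_eq (congrFun h1 i) ((hM _ ⟨x, hx, rfl⟩ i).trans (hz i).ge)
  refine ⟨cat x v, fun t => ?_⟩
  rw [Equiv.Perm.inv_eq_iff_eq, catInf_cat, hg x hx, ← catInf_cat, hv]

theorem exists_induces_iff {n : ℕ} {σ : Equiv.Perm (Pt n)} :
    (∃ f : Tup n ≃. Tup n, IsRIFin f ∧ Induces f σ) ↔ IsLocal σ :=
  ⟨fun ⟨_, hf, h⟩ => isLocal_of_induces hf h, exists_induces_of_isLocal⟩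

/-! ### The Brin-Thompson group -/

/-- The Brin-Thompson group `nV`: the group of the permutations of `nA^ω`, `A = {0,1}`, that are
induced by elements of `nRI^fin`. -/
def nV (n : ℕ) : Subgroup (Equiv.Perm (Pt n)) where
  carrier := {σ | ∃ f : Tup n ≃. Tup n, IsRIFin f ∧ Induces f σ}
  mul_mem' ha hb := exists_induces_iff.2 ((exists_induces_iff.1 ha).mul (exists_induces_iff.1 hb))
  one_mem' := exists_induces_iff.2 IsLocal.one
  inv_mem' ha := exists_induces_iff.2 (exists_induces_iff.1 ha).inv

/-! ### Words over a generating set -/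

/-- The alphabet `Γ ∪ Γ⁻¹` of the words over a set `Γ` of group elements. -/
abbrev Letter {G : Type} [Group G] (S : Set G) : Type := {g : G // g ∈ S ∨ g⁻¹ ∈ S}

/-- The value of a word in the group. -/
def wordVal {G : Type} [Group G] {S : Set G} (w : List (Letter S)) : G :=
  (w.map fun a => (a : G)).prod

/-- The word problem of a group over a generating set, as a set of words. -/
def wordProblem {G : Type} [Group G] (S : Set G) : Set (List (Letter S)) :=
  {w | wordVal w = 1}

/-- `F` chooses for each letter an element of `nRI^fin` (equivalently, a table) that represents
it. -/
def IsTableChoice {n : ℕ} {S : Set (nV n)} (F : Letter S → (Tup n ≃. Tup n)) : Prop :=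
  ∀ a : Letter S, IsRIFin (F a) ∧ Induces (F a) ((a : nV n) : Equiv.Perm (Pt n))

/-- The partial function `f_w = f_{γ_t} ∘ ⋯ ∘ f_{γ_1}` of a word `w = γ_t ⋯ γ_1`
(the last letter is applied first). -/
def wordFun {n : ℕ} {L : Type} (F : L → (Tup n ≃. Tup n)) : List L → (Tup n ≃. Tup n)
  | [] => PEquiv.refl (Tup n)
  | a :: w => (wordFun F w).trans (F a)

/-- The constant `c_Γ = max {ℓ(γ) : γ ∈ Γ}`. -/
noncomputable def maxEll {n : ℕ} {L : Type} (F : L → (Tup n ≃. Tup n)) : ℕ :=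
  ⨆ a : L, ell (F a)

/-! ### Complexity classes -/

/-- Tuples of bit strings as strings: each coordinate is followed by an end marker. -/
def encTup {m : ℕ} (x : Tup m) : List (Option Bool) :=
  (List.ofFn fun i => (x i).map some ++ [none]).flatten

/-- Pairs of a tuple of bit strings and a word over `L`, as strings. -/
def encPair {m : ℕ} {L : Type} (p : Tup m × List L) : List (Option Bool ⊕ L) :=
  (encTup p.1).map Sum.inl ++ p.2.map Sum.inr

/-- Possibly undefined values in `nA*`, as strings: the empty string stands for "undefined". -/
def encOpt {m : ℕ} : Option (Tup m) → List (Option Bool)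
  | none => []
  | some y => none :: encTup y

open Classical in
/-- `R ∈ P` for a predicate `R` on `mA* × L*`, `A = {0,1}`: a Turing machine decides `R` in
polynomial time. -/
def InP {m : ℕ} {L : Type} (R : Tup m → List L → Prop) : Prop :=
  Nonempty (Turing.TM2ComputableInPolyTime (encPair (m := m) (L := L)) Computability.encodeBool
    fun p => decide (R p.1 p.2))

/-- The complexity class coNP. -/
def InCoNP {L : Type} (T : Set (List L)) : Prop :=
  ∃ (m : ℕ) (R : Tup m → List L → Prop) (p : Polynomial ℕ), 1 ≤ m ∧ InP R ∧
    T = {w | ∀ x : Tup m, (∀ i, (x i).length ≤ p.eval w.length) → R x w}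

/-- The partial map `(x, w) ↦ f_w(x)` is computable by a Turing machine in polynomial time. -/
def EvalInPolyTime {n : ℕ} {L : Type} (F : L → (Tup n ≃. Tup n)) : Prop :=
  Nonempty (Turing.TM2ComputableInPolyTime (encPair (m := n) (L := L)) (encOpt (m := n))
    fun p => wordFun F p.2 p.1)

end BrinThompson

open BrinThompson

/-!
Two facts about a morphism `f` in `nRI^fin` carry the theorem. By maximality of the domain code, `f`
is defined on every tuple whose coordinates have length at least `ell f` (`exists_apply_eq`), and it
changes the length of a coordinate by at most `ell f` (`length_apply_le`). Hence on a tuple with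
coordinates of length `maxEll F * w.length` all partial evaluations of a word `w` are defined and of
length at most twice that. Every point of `nA^ω` has such a tuple as an initial factor, and the
value of `w` acts on the point by applying `wordFun F w` to this initial factor, so `w` is trivial
if and only if it fixes all these tuples (`wordVal_eq_one_iff`).

For the complexity statements, note that `f` acts on the first `ell f` symbols of each coordinate
only (`apply_eq_map_takeTup`). If the coordinates are kept on separate stacks, then a letter is
applied by one bounded rewriting of the tops of the stacks. Machines whose steps are arbitrary
rewritings of the `D` topmost symbols of all stacks are Turing machines, because one statement of a
Turing machine in the sense of `Turing.TM2` can pop the tops into a finite buffer, apply a function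
to the buffer, and push it back (`computableInPolyTime_of_window`). One machine of this kind serves
both for the evaluation of words and for the predicate in the coNP description: it applies the word
in linear time (`runsIn_evalStart`), then either writes out the current tuple or compares it with a
copy of the initial one and with a unary counter of length `maxEll F * w.length`, and empties its
stacks. As a step lengthens each stack by a bounded amount only (`RunsIn.length_le`), the sizes of
all stacks, and with them the time for the final phases, are linear in the length of the input and
the time used before.
-/

namespace BrinThompson

/-! ### Machines that rewrite the tops of their stacks -/

section Window

variable {K Q : Type} {Γ : K → Type}

/-- One step of a machine with stacks `S k`, `k : K`. The rule `δ` reads the state and the `D`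
topmost symbols of all stacks, and returns the next state (`none` if the machine halts) and the
lists that replace those symbols. A halted configuration is a fixed point. -/
def windowStep (D : ℕ) (δ : Q → (∀ k, List (Γ k)) → Option Q × ∀ k, List (Γ k)) :
    Option Q × (∀ k, List (Γ k)) → Option Q × (∀ k, List (Γ k))
  | (none, S) => (none, S)
  | (some q, S) =>
    ((δ q fun k => (S k).take D).1, fun k => (δ q fun k => (S k).take D).2 k ++ (S k).drop D)

/-- The lists of length at most `d`: the contents of the buffers in which a simulating machine
holds the tops of its stacks. -/
abbrev Buf (d : ℕ) (A : Type) : Type := {l : List A // l.length ≤ d}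

instance (d : ℕ) (A : Type) [Finite A] : Finite (Buf d A) :=
  (List.finite_length_le A d).to_subtype

/-- The list `l`, cut off after `d` symbols. -/
def Buf.trunc (d : ℕ) {A : Type} (l : List A) : Buf d A := ⟨l.take d, List.length_take_le d l⟩

theorem Buf.trunc_of_le {d : ℕ} {A : Type} {l : List A} (h : l.length ≤ d) :
    Buf.trunc d l = ⟨l, h⟩ := Subtype.ext (List.take_of_length_le h)

theorem Buf.trunc_val {d : ℕ} {A : Type} (b : Buf d A) : Buf.trunc d b.1 = b :=
  Buf.trunc_of_le b.2

open Turing Turing.TM2 Turing.TM2.Stmt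

variable [DecidableEq K] {d : ℕ}

/-- Pop up to `m` symbols of the stack `k` and append them to the buffer of `k`. -/
def popMany (Q : Type) (Γ : K → Type) (d : ℕ) (k : K) :
    ℕ → Stmt Γ Unit (Q × ∀ k, Buf d (Γ k)) → Stmt Γ Unit (Q × ∀ k, Buf d (Γ k))
  | 0, s => s
  | m + 1, s =>
    pop k (fun v o => (v.1, Function.update v.2 k (Buf.trunc d ((v.2 k).1 ++ o.toList))))
      (popMany Q Γ d k m s)

theorem stepAux_popMany (k : K) (s : Stmt Γ Unit (Q × ∀ k, Buf d (Γ k))) (m : ℕ) :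
    ∀ (v : Q × ∀ k, Buf d (Γ k)) (S : ∀ k, List (Γ k)), (v.2 k).1.length + m ≤ d →
      stepAux (popMany Q Γ d k m s) v S =
        stepAux s (v.1, Function.update v.2 k (Buf.trunc d ((v.2 k).1 ++ (S k).take m)))
          (Function.update S k ((S k).drop m)) := by
  induction m with
  | zero => intro v S _; simp [popMany, Buf.trunc_val]
  | succ m ih =>
    intro v S h
    have hl : ((v.2 k).1 ++ (S k).head?.toList).length ≤ d := by
      cases S k <;> simp <;> omega
    rw [popMany, stepAux, ih]
    · simp only [Function.update_self, Function.update_idem, Buf.trunc_of_le hl]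
      cases S k <;> simp
    · simp only [Function.update_self, Buf.trunc_of_le hl]
      cases S k <;> simp <;> omega

/-- Pop up to `D` symbols of each stack in the list into the buffers. -/
def popAll (Q : Type) (Γ : K → Type) (d D : ℕ) :
    List K → Stmt Γ Unit (Q × ∀ k, Buf d (Γ k)) → Stmt Γ Unit (Q × ∀ k, Buf d (Γ k))
  | [], s => s
  | k :: l, s => popMany Q Γ d k D (popAll Q Γ d D l s)

theorem stepAux_popAll {D : ℕ} (hD : D ≤ d) (s : Stmt Γ Unit (Q × ∀ k, Buf d (Γ k))) (l : List K) :
    ∀ (v : Q × ∀ k, Buf d (Γ k)) (S : ∀ k, List (Γ k)), l.Nodup → (∀ k ∈ l, (v.2 k).1 = []) →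
      stepAux (popAll Q Γ d D l s) v S =
        stepAux s (v.1, fun k => if k ∈ l then Buf.trunc d ((S k).take D) else v.2 k)
          (fun k => if k ∈ l then (S k).drop D else S k) := by
  induction l with
  | nil => intro v S _ _; simp [popAll]
  | cons j l ih =>
    intro v S hnd hv
    rw [List.nodup_cons] at hnd
    have hj : (v.2 j).1 = [] := hv j (by simp)
    rw [popAll, stepAux_popMany _ _ _ _ _ (by rw [hj]; simpa using hD), ih _ _ hnd.2]
    · congr 1
      · refine Prod.ext rfl (funext fun k => ?_)
        by_cases hk : k = j
        · subst hk; simp [hnd.1, hj]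
        · simp [hk]
      · funext k
        by_cases hk : k = j
        · subst hk; simp [hnd.1]
        · simp [hk]
    · intro k hk
      have hkj : k ≠ j := fun h => hnd.1 (h ▸ hk)
      simpa [hkj] using hv k (by simp [hk])

open Classical in
/-- Push up to `m` symbols of the buffer of `k` on the stack `k`, the last symbol first. If the
alphabet of `k` is empty, then there is nothing to push. -/
noncomputable def pushMany (Q : Type) (Γ : K → Type) (d : ℕ) (k : K) :
    ℕ → Stmt Γ Unit (Q × ∀ k, Buf d (Γ k)) → Stmt Γ Unit (Q × ∀ k, Buf d (Γ k))
  | 0, s => s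
  | m + 1, s =>
    if h : Nonempty (Γ k) then
      branch (fun v => (v.2 k).1.isEmpty) s
        (push k (fun v => (v.2 k).1.getLast?.getD (Classical.choice h))
          (load (fun v => (v.1, Function.update v.2 k (Buf.trunc d (v.2 k).1.dropLast)))
            (pushMany Q Γ d k m s)))
    else s

theorem stepAux_pushMany (k : K) (s : Stmt Γ Unit (Q × ∀ k, Buf d (Γ k))) (m : ℕ) :
    ∀ (v : Q × ∀ k, Buf d (Γ k)) (S : ∀ k, List (Γ k)), (v.2 k).1.length ≤ m →
      stepAux (pushMany Q Γ d k m s) v S =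
        stepAux s (v.1, Function.update v.2 k (Buf.trunc d []))
          (Function.update S k ((v.2 k).1 ++ S k)) := by
  have hnil : ∀ (v : Q × ∀ k, Buf d (Γ k)) (S : ∀ k, List (Γ k)), (v.2 k).1 = [] →
      stepAux s v S = stepAux s (v.1, Function.update v.2 k (Buf.trunc d []))
          (Function.update S k ((v.2 k).1 ++ S k)) := by
    intro v S h
    have : Buf.trunc d [] = v.2 k := by rw [← h, Buf.trunc_val]
    rw [this, h, Function.update_eq_self, List.nil_append, Function.update_eq_self]
  induction m with
  | zero =>
    intro v S h
    exact hnil v S (List.eq_nil_of_length_eq_zero (by omega))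
  | succ m ih =>
    intro v S h
    rcases List.eq_nil_or_concat (v.2 k).1 with h0 | ⟨l, a, hl⟩
    · rw [← hnil v S h0, pushMany]
      split_ifs
      · simp [h0]
      · rfl
    · have hd : l.length ≤ d := by
        have h2 := (v.2 k).2
        rw [hl, List.length_concat] at h2
        omega
      rw [pushMany, dif_pos ⟨a⟩]
      rw [List.concat_eq_append] at hl
      have he : (l ++ [a]).isEmpty = false := by simp
      simp only [stepAux, hl, he, cond_false, List.dropLast_concat, Buf.trunc_of_le hd]
      rw [ih]
      · simp
      · rw [hl, List.length_append] at h
        simpa using h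

/-- Push the buffers of the stacks in the list. -/
noncomputable def pushAll (Q : Type) (Γ : K → Type) (d : ℕ) :
    List K → Stmt Γ Unit (Q × ∀ k, Buf d (Γ k)) → Stmt Γ Unit (Q × ∀ k, Buf d (Γ k))
  | [], s => s
  | k :: l, s => pushMany Q Γ d k d (pushAll Q Γ d l s)

theorem stepAux_pushAll (s : Stmt Γ Unit (Q × ∀ k, Buf d (Γ k))) (l : List K) :
    ∀ (v : Q × ∀ k, Buf d (Γ k)) (S : ∀ k, List (Γ k)), l.Nodup →
      stepAux (pushAll Q Γ d l s) v S =
        stepAux s (v.1, fun k => if k ∈ l then Buf.trunc d [] else v.2 k)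
          (fun k => if k ∈ l then (v.2 k).1 ++ S k else S k) := by
  induction l with
  | nil => intro v S _; simp [pushAll]
  | cons j l ih =>
    intro v S hnd
    rw [List.nodup_cons] at hnd
    rw [pushAll, stepAux_pushMany _ _ _ _ _ (v.2 j).2, ih _ _ hnd.2]
    congr 1
    · refine Prod.ext rfl (funext fun k => ?_)
      by_cases hk : k = j
      · subst hk; simp [hnd.1]
      · simp [hk]
    · funext k
      by_cases hk : k = j
      · subst hk; simp [hnd.1]
      · simp [hk]

variable [Fintype K]

/-- The statement that performs one step of the machine with rule `δ`: it pops the tops of all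
stacks into the buffers, applies `δ` to the buffers, and pushes them back. The state `none` lasts
only from the moment `δ` asks to halt until the end of the statement. -/
noncomputable def windowStmt (d D : ℕ) (start : Q)
    (δ : Q → (∀ k, List (Γ k)) → Option Q × ∀ k, List (Γ k)) :
    Stmt Γ Unit (Option Q × ∀ k, Buf d (Γ k)) :=
  popAll (Option Q) Γ d D Finset.univ.toList <|
    load (fun v => match v.1 with
      | none => v
      | some q => ((δ q fun k => (v.2 k).1).1,
          fun k => Buf.trunc d ((δ q fun k => (v.2 k).1).2 k))) <|
    pushAll (Option Q) Γ d Finset.univ.toList <|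
    branch (fun v => v.1.isNone) (load (fun _ => (some start, fun _ => Buf.trunc d [])) halt)
      (goto fun _ => ())

/-- The configuration of the simulating machine that represents a configuration of the simulated
one. -/
def windowCfg (d : ℕ) (start : Q) :
    Option Q × (∀ k, List (Γ k)) → Cfg Γ Unit (Option Q × ∀ k, Buf d (Γ k))
  | (none, S) => ⟨none, (some start, fun _ => Buf.trunc d []), S⟩
  | (some q, S) => ⟨some (), (some q, fun _ => Buf.trunc d []), S⟩

theorem step_windowStmt {D : ℕ} (hD : D ≤ d) (start : Q)
    {δ : Q → (∀ k, List (Γ k)) → Option Q × ∀ k, List (Γ k)}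
    (hδ : ∀ q w, (∀ k, (w k).length ≤ D) → ∀ k, ((δ q w).2 k).length ≤ d)
    (q : Q) (S : ∀ k, List (Γ k)) :
    TM2.step (fun _ : Unit => windowStmt d D start δ) (windowCfg d start (some q, S)) =
      some (windowCfg d start (windowStep D δ (some q, S))) := by
  have hw : ∀ k, ((S k).take D).length ≤ d := fun k =>
    (List.length_take_le D (S k)).trans hD
  have hw' := hδ q (fun k => (S k).take D) fun k => List.length_take_le D (S k)
  rw [windowCfg, step, windowStmt, stepAux_popAll hD _ _ _ _ (Finset.nodup_toList _)
    (fun k _ => by simp [Buf.trunc])]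
  rw [stepAux, stepAux_pushAll _ _ _ _ (Finset.nodup_toList _)]
  simp only [Finset.mem_toList, Finset.mem_univ, if_true, Buf.trunc_of_le (hw _),
    Buf.trunc_of_le (hw' _), windowStep]
  cases (δ q fun k => (S k).take D).1 <;> simp [windowCfg]

omit [DecidableEq K] [Fintype K] in
theorem windowStep_iterate_none (D : ℕ) (δ : Q → (∀ k, List (Γ k)) → Option Q × ∀ k, List (Γ k))
    (S : ∀ k, List (Γ k)) (t : ℕ) : (windowStep D δ)^[t] (none, S) = (none, S) :=
  Function.iterate_fixed rfl t

/-- A run that halts is followed by the simulating machine, which stops at the first configuration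
that is halted. -/
theorem exists_iterate_step_windowStmt {D : ℕ} (hD : D ≤ d) (start : Q)
    {δ : Q → (∀ k, List (Γ k)) → Option Q × ∀ k, List (Γ k)}
    (hδ : ∀ q w, (∀ k, (w k).length ≤ D) → ∀ k, ((δ q w).2 k).length ≤ d)
    (S' : ∀ k, List (Γ k)) (t : ℕ) :
    ∀ (q : Q) (S : ∀ k, List (Γ k)), (windowStep D δ)^[t] (some q, S) = (none, S') →
      ∃ t' ≤ t, (flip bind (TM2.step fun _ : Unit => windowStmt d D start δ))^[t']
        (some (windowCfg d start (some q, S))) = some (windowCfg d start (none, S')) := by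
  induction t with
  | zero => intro q S h; simp at h
  | succ t ih =>
    intro q S h
    rw [Function.iterate_succ_apply] at h
    have hs := step_windowStmt hD start hδ q S
    generalize windowStep D δ (some q, S) = c at h hs
    obtain ⟨_ | q₁, S₁⟩ := c
    · rw [windowStep_iterate_none] at h
      refine ⟨1, by omega, ?_⟩
      rw [← h]
      exact hs
    · obtain ⟨t', ht', h'⟩ := ih q₁ S₁ h
      refine ⟨t' + 1, by omega, ?_⟩
      rw [Function.iterate_succ_apply, ← h']
      exact congrArg _ hs

omit [DecidableEq K] in
/-- As there are finitely many states and tops, the lists that the rule writes have bounded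
length. -/
theorem exists_length_rule_le [Finite Q] [∀ k, Finite (Γ k)] (D : ℕ)
    (δ : Q → (∀ k, List (Γ k)) → Option Q × ∀ k, List (Γ k)) :
    ∃ d, D ≤ d ∧ ∀ q w, (∀ k, (w k).length ≤ D) → ∀ k, ((δ q w).2 k).length ≤ d := by
  obtain ⟨d, hd⟩ := (Set.finite_range
    fun p : (Q × ∀ k, Buf D (Γ k)) × K => ((δ p.1.1 fun k => (p.1.2 k).1).2 p.2).length).bddAbove
  exact ⟨max D d, le_max_left _ _, fun q w hw k =>
    (hd ⟨((q, fun k => ⟨w k, hw k⟩), k), rfl⟩).trans (le_max_right _ _)⟩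

omit [Fintype K] in
/-- The left-hand side is how `Turing.initList` and `Turing.haltList` describe the stacks. -/
theorem dite_cast_eq_update (k₀ : K) (l : List (Γ k₀)) (k : K) :
    (if h : k = k₀ then (by rw [h]; exact l : List (Γ k)) else []) =
      Function.update (fun _ => []) k₀ l k := by
  by_cases hk : k = k₀
  · subst hk; simp
  · simp [hk]

/-- A machine that rewrites the tops of its stacks in polynomial time is a Turing machine. -/
theorem computableInPolyTime_of_window [Finite Q] [∀ k, Finite (Γ k)] {α β : Type} {k₀ k₁ : K}
    (ea : α → List (Γ k₀)) (eb : β → List (Γ k₁)) (f : α → β) (D : ℕ) (start : Q)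
    (δ : Q → (∀ k, List (Γ k)) → Option Q × ∀ k, List (Γ k)) (p : Polynomial ℕ)
    (h : ∀ a, ∃ t ≤ p.eval (ea a).length,
      (windowStep D δ)^[t] (some start, Function.update (fun _ => []) k₀ (ea a)) =
        (none, Function.update (fun _ => []) k₁ (eb (f a)))) :
    Nonempty (TM2ComputableInPolyTime ea eb f) := by
  obtain ⟨d, hD, hδ⟩ := exists_length_rule_le D δ
  let : ∀ k, Fintype (Γ k) := fun k => Fintype.ofFinite _
  let : Fintype (Option Q × ∀ k, Buf d (Γ k)) := Fintype.ofFinite _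
  let tm : FinTM2 :=
    { K := K, k₀ := k₀, k₁ := k₁, Γ := Γ, Λ := Unit, main := (),
      σ := Option Q × ∀ k, Buf d (Γ k)
      initialState := (some start, fun _ => Buf.trunc d [])
      m := fun _ => windowStmt d D start δ }
  have hi : ∀ l : List (Γ k₀),
      initList tm l = windowCfg d start (some start, Function.update (fun _ => []) k₀ l) :=
    fun l => congrArg (Cfg.mk _ _) (funext fun k => dite_cast_eq_update k₀ l k)
  have ho : ∀ l : List (Γ k₁),
      haltList tm l = windowCfg d start (none, Function.update (fun _ => []) k₁ l) :=
    fun l => congrArg (Cfg.mk _ _) (funext fun k => dite_cast_eq_update k₁ l k)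
  choose t ht hrun using h
  have hex := fun a => exists_iterate_step_windowStmt hD start hδ _ _ _ _ (hrun a)
  choose t' ht' hrun' using hex
  exact ⟨{
    tm := tm
    inputAlphabet := Equiv.refl _
    outputAlphabet := Equiv.refl _
    time := p
    outputsFun := fun a =>
      { steps := t' a
        evals_in_steps := by
          have h1 : List.map (Equiv.refl (Γ k₀)).invFun (ea a) = ea a := List.map_id _
          have h2 : List.map (Equiv.refl (Γ k₁)).invFun (eb (f a)) = eb (f a) := List.map_id _
          change (flip bind _)^[t' a]
              (some (initList tm (List.map (Equiv.refl (Γ k₀)).invFun (ea a)))) =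
            some (haltList tm (List.map (Equiv.refl (Γ k₁)).invFun (eb (f a))))
          rw [h1, h2, hi, ho]
          exact hrun' a
        steps_le_m := (ht' a).trans (ht a) } }⟩

end Window

/-! ### Evaluation of right ideal morphisms and of words -/

/-- The initial factors of length `N` of the coordinates (the whole coordinate if it is shorter). -/
def takeTup {n : ℕ} (N : ℕ) (x : Tup n) : Tup n := fun i => (x i).take N

/-- The coordinates without their first `N` symbols. -/
def dropTup {n : ℕ} (N : ℕ) (x : Tup n) : Tup n := fun i => (x i).drop N

theorem cat_take_drop {n : ℕ} (N : ℕ) (x : Tup n) : cat (takeTup N x) (dropTup N x) = x :=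
  funext fun _ => List.take_append_drop _ _

section Morphism

variable {n : ℕ} {f : Tup n ≃. Tup n}

/-- The initial factor order is well-founded, so that minimal elements exist. -/
theorem exists_mem_domC_initLE {x y : Tup n} (h : f x = some y) :
    ∃ p ∈ domC f, InitLE p x := by
  obtain ⟨p, ⟨hp, hpx⟩, hmin⟩ := (measure fun q : Tup n => ∑ i, (q i).length).wf.has_min
    {q | (∃ y, f q = some y) ∧ InitLE q x} ⟨x, ⟨y, h⟩, fun _ => [], by funext i; simp [cat]⟩
  refine ⟨p, ⟨hp, fun q hq hqp => ?_⟩, hpx⟩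
  obtain ⟨u, hu⟩ := hqp
  obtain ⟨v, hv⟩ := hpx
  have hq' := hmin q ⟨hq, cat u v, by rw [← cat_assoc, hu, hv]⟩
  have hlen : ∀ i, (p i).length = (q i).length + (u i).length := fun i => by
    rw [← hu]; simp [cat]
  have hsum : ∑ i, (p i).length ≤ ∑ i, (q i).length := not_lt.1 hq'
  simp only [hlen, Finset.sum_add_distrib] at hsum
  -- By minimality of the total length, `q` is not shorter than `p`.
  have h0 : ∑ i, (u i).length = 0 := by omega
  rw [Finset.sum_eq_zero_iff] at h0
  funext i
  rw [← hu]
  simp [cat, List.eq_nil_of_length_eq_zero (h0 i (Finset.mem_univ i))]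

theorem length_le_ell (hf : IsRIFin f) {z : Tup n} (hz : z ∈ domC f ∪ imC f) (i : Fin n) :
    (z i).length ≤ ell f := by
  obtain ⟨N, hN⟩ := exists_length_le (hf.finite_domC.union hf.finite_imC)
  refine le_csSup ⟨N, ?_⟩ ⟨z, hz, i, rfl⟩
  rintro k ⟨z', hz', i', rfl⟩
  exact hN z' hz' i'

theorem map_mem_imC (hf : IsRIFin f) {p q : Tup n} (hp : p ∈ domC f) (hq : f p = some q) :
    q ∈ imC f := by
  refine ⟨⟨p, hq⟩, ?_⟩
  rintro q' ⟨x, hx⟩ ⟨v, rfl⟩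
  have hxp : cat x v = p := f.inj (hf.map_cat _ _ v hx) hq
  have := hp.2 x ⟨q', hx⟩ ⟨v, hxp⟩
  subst this
  rw [hx] at hq
  exact Option.some.inj hq

/-- Every value of `f` arises by replacing an element of the domain code by an element of the
image code. -/
theorem exists_code_factor (hf : IsRIFin f) {x y : Tup n} (h : f x = some y) :
    ∃ p q v, p ∈ domC f ∧ q ∈ imC f ∧ f p = some q ∧ cat p v = x ∧ cat q v = y := by
  obtain ⟨p, hp, v, rfl⟩ := exists_mem_domC_initLE h
  obtain ⟨q, hq⟩ := hp.1
  refine ⟨p, q, v, hp, map_mem_imC hf hp hq, hq, rfl, ?_⟩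
  rw [hf.map_cat _ _ v hq] at h
  exact Option.some.inj h

theorem length_apply_le (hf : IsRIFin f) {x y : Tup n} (h : f x = some y) (i : Fin n) :
    (y i).length ≤ (x i).length + ell f ∧ (x i).length ≤ (y i).length + ell f := by
  obtain ⟨p, q, v, hp, hq, -, rfl, rfl⟩ := exists_code_factor hf h
  have h1 := length_le_ell hf (Or.inl hp) i
  have h2 := length_le_ell hf (Or.inr hq) i
  simp only [cat, List.length_append]
  omega

/-- The morphism is determined by its values on short tuples: it acts on initial factors. -/
theorem apply_eq_map_takeTup (hf : IsRIFin f) {N : ℕ} (hN : ell f ≤ N) (x : Tup n) :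
    f x = (f (takeTup N x)).map fun z => cat z (dropTup N x) := by
  ext y
  constructor
  · intro h
    obtain ⟨p, q, v, hp, -, hpq, rfl, rfl⟩ := exists_code_factor hf h
    have hl := fun i => (length_le_ell hf (Or.inl hp) i).trans hN
    have h1 : takeTup N (cat p v) = cat p fun i => (v i).take (N - (p i).length) := by
      funext i
      simp [takeTup, cat, List.take_append, List.take_of_length_le (hl i)]
    have h2 : dropTup N (cat p v) = fun i => (v i).drop (N - (p i).length) := by
      funext i
      simp [dropTup, cat, List.drop_append, List.drop_of_length_le (hl i)]
    rw [h1, h2, hf.map_cat _ _ _ hpq]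
    simp only [Option.map_some, cat_assoc]
    exact congrArg some (congrArg _ (funext fun i => List.take_append_drop _ _))
  · intro h
    obtain ⟨z, hz, rfl⟩ := Option.map_eq_some_iff.1 h
    have := hf.map_cat _ _ (dropTup N x) hz
    rwa [cat_take_drop] at this

/-- By maximality of the domain code, `f` is defined on all tuples with long coordinates. -/
theorem exists_apply_eq (hf : IsRIFin f) {x : Tup n} (hx : ∀ i, ell f ≤ (x i).length) :
    ∃ y, f x = some y := by
  have h1 : ∃ p ∈ domC f, ∃ z, IsJoin p x z := by
    by_contra hcon
    push Not at hcon
    -- Otherwise `x` could be added to the domain code.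
    have hj : Joinless (insert x (domC f)) := by
      rintro u (rfl | hu) v (rfl | hv) huv
      · exact absurd rfl huv
      · rintro ⟨z, h1, h2, h3⟩
        exact hcon v hv z ⟨h2, h1, fun z' a b => h3 z' b a⟩
      · rintro ⟨z, hz⟩
        exact hcon u hu z hz
      · exact hf.maximal_domC.prop u hu v hv huv
    have hx' := hf.maximal_domC.2 hj (Set.subset_insert _ _) (Set.mem_insert _ _)
    have hself : ∃ z, IsJoin x x z :=
      exists_join_iff.2 ⟨fun _ => Stream'.const false, _, rfl⟩
    exact hcon x hx' _ hself.choose_spec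
  obtain ⟨p, hp, z, hpz, hxz, -⟩ := h1
  obtain ⟨v, rfl⟩ : InitLE p x := initLE_iff.2 fun i =>
    List.prefix_of_prefix_length_le (initLE_iff.1 hpz i) (initLE_iff.1 hxz i)
      ((length_le_ell hf (Or.inl hp) i).trans (hx i))
  obtain ⟨q, hq⟩ := hp.1
  exact ⟨_, hf.map_cat _ _ v hq⟩

theorem Induces.apply_catInf {σ : Equiv.Perm (Pt n)} (hf : IsRIFin f) (h : Induces f σ)
    {x y : Tup n} (hxy : f x = some y) (s : Pt n) : σ (catInf x s) = catInf y s := by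
  obtain ⟨p, q, v, hp, -, hpq, rfl, rfl⟩ := exists_code_factor hf hxy
  rw [catInf_cat, catInf_cat, h p hp q hpq]

end Morphism

section Words

variable {n : ℕ}

theorem wordFun_cons {L : Type} (F : L → (Tup n ≃. Tup n)) (a : L) (w : List L) (x : Tup n) :
    wordFun F (a :: w) x = (wordFun F w x).bind (F a) := rfl

theorem wordFun_append {L : Type} (F : L → (Tup n ≃. Tup n)) (v w : List L) (x : Tup n) :
    wordFun F (v ++ w) x = (wordFun F w x).bind (wordFun F v) := by
  induction v with
  | nil =>
    rw [List.nil_append]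
    cases wordFun F w x <;> rfl
  | cons a v ih =>
    rw [List.cons_append, wordFun_cons, ih]
    cases wordFun F w x <;> rfl

theorem wordFun_singleton {L : Type} (F : L → (Tup n ≃. Tup n)) (a : L) (x : Tup n) :
    wordFun F [a] x = F a x := rfl

variable {S : Set (nV n)} {F : Letter S → (Tup n ≃. Tup n)}

theorem finite_letter {G : Type} [Group G] {S : Set G} (hS : S.Finite) : Finite (Letter S) :=
  (hS.union (hS.preimage inv_injective.injOn)).to_subtype

theorem ell_le_maxEll {L : Type} [Finite L] (F : L → (Tup n ≃. Tup n)) (a : L) :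
    ell (F a) ≤ maxEll F :=
  le_ciSup (f := fun a => ell (F a)) (Set.finite_range _).bddAbove a

/-- A letter changes the length of a coordinate by at most `maxEll F`. The second bound is what
keeps the coordinates long enough for the letters that follow. -/
theorem length_wordFun_le [Finite (Letter S)] (hF : IsTableChoice F) (w : List (Letter S)) :
    ∀ {x y : Tup n}, wordFun F w x = some y → ∀ i,
      (y i).length ≤ (x i).length + maxEll F * w.length ∧
        (x i).length ≤ (y i).length + maxEll F * w.length := by
  induction w with
  | nil =>
    intro x y h i
    obtain rfl : x = y := Option.some.inj h
    simp
  | cons a w ih =>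
    intro x y h i
    rw [wordFun_cons] at h
    obtain ⟨z, hz, hzy⟩ := Option.bind_eq_some_iff.1 h
    have h1 := ih hz i
    have h2 := length_apply_le (hF a).1 hzy i
    have h3 := ell_le_maxEll F a
    rw [List.length_cons, mul_add, mul_one]
    omega

theorem exists_wordFun_eq [Finite (Letter S)] (hF : IsTableChoice F) (w : List (Letter S))
    {x : Tup n} (hx : ∀ i, maxEll F * w.length ≤ (x i).length) : ∃ y, wordFun F w x = some y := by
  induction w with
  | nil => exact ⟨x, rfl⟩
  | cons a w ih =>
    simp only [List.length_cons, mul_add, mul_one] at hx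
    obtain ⟨z, hz⟩ := ih fun i => le_trans (Nat.le_add_right _ _) (hx i)
    have h3 := ell_le_maxEll F a
    obtain ⟨y, hy⟩ := exists_apply_eq (hF a).1 (x := z) fun i => by
      have h1 := (length_wordFun_le hF w hz i).2
      have h2 := hx i
      omega
    exact ⟨y, by rw [wordFun_cons, hz]; exact hy⟩

theorem wordVal_apply_catInf (hF : IsTableChoice F) (w : List (Letter S)) :
    ∀ {x y : Tup n}, wordFun F w x = some y → ∀ s,
      ((wordVal w : nV n) : Equiv.Perm (Pt n)) (catInf x s) = catInf y s := by
  induction w with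
  | nil =>
    intro x y h s
    obtain rfl : x = y := Option.some.inj h
    simp [wordVal]
  | cons a w ih =>
    intro x y h s
    rw [wordFun_cons] at h
    obtain ⟨z, hz, hzy⟩ := Option.bind_eq_some_iff.1 h
    have h1 : (wordVal (a :: w) : nV n) = (a : nV n) * wordVal w := by simp [wordVal]
    rw [h1, Subgroup.coe_mul, Equiv.Perm.mul_apply, ih hz,
      (hF a).2.apply_catInf (hF a).1 hzy]

/-- A word is trivial if and only if it fixes all tuples whose coordinates are long enough for all
partial evaluations to be defined. -/
theorem wordVal_eq_one_iff [Finite (Letter S)] (hF : IsTableChoice F) (w : List (Letter S)) :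
    wordVal w = 1 ↔
      ∀ x : Tup n, (∀ i, (x i).length = maxEll F * w.length) → wordFun F w x = some x := by
  constructor
  · intro h x hx
    obtain ⟨y, hy⟩ := exists_wordFun_eq hF w fun i => (hx i).ge
    have hyx : ∀ s, catInf y s = catInf x s := fun s => by
      rw [← wordVal_apply_catInf hF w hy, h]; rfl
    rw [hy, catInf_left_inj hyx]
  · intro h
    refine Subtype.ext (Equiv.ext fun p => ?_)
    obtain ⟨x, s, hx, rfl⟩ := exists_catInf (maxEll F * w.length) p
    exact wordVal_apply_catInf hF w (h x hx) s

theorem exists_isTableChoice (S : Set (nV n)) : ∃ F : Letter S → (Tup n ≃. Tup n),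
    IsTableChoice F := by
  choose F hF using fun a : Letter S => (a : nV n).2
  exact ⟨F, hF⟩

end Words

/-! ### Runs of bounded length -/

section Runs

variable {K Q : Type} {Γ : K → Type} {D : ℕ}
  {δ : Q → (∀ k, List (Γ k)) → Option Q × ∀ k, List (Γ k)}

/-- The machine gets from one configuration to the other in at most `t` steps. -/
def RunsIn (D : ℕ) (δ : Q → (∀ k, List (Γ k)) → Option Q × ∀ k, List (Γ k)) (t : ℕ)
    (c c' : Option Q × (∀ k, List (Γ k))) : Prop :=
  ∃ s ≤ t, (windowStep D δ)^[s] c = c'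

theorem RunsIn.refl (c : Option Q × (∀ k, List (Γ k))) : RunsIn D δ 0 c c := ⟨0, le_rfl, rfl⟩

theorem RunsIn.single {c c' : Option Q × (∀ k, List (Γ k))} (h : windowStep D δ c = c') :
    RunsIn D δ 1 c c' := ⟨1, le_rfl, h⟩

theorem RunsIn.mono {s t : ℕ} {c c' : Option Q × (∀ k, List (Γ k))} (h : RunsIn D δ s c c')
    (hst : s ≤ t) : RunsIn D δ t c c' :=
  let ⟨r, hr, h⟩ := h
  ⟨r, hr.trans hst, h⟩

theorem RunsIn.trans {s t : ℕ} {c c' c'' : Option Q × (∀ k, List (Γ k))}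
    (h : RunsIn D δ s c c') (h' : RunsIn D δ t c' c'') : RunsIn D δ (s + t) c c'' := by
  obtain ⟨r, hr, rfl⟩ := h
  obtain ⟨r', hr', rfl⟩ := h'
  exact ⟨r' + r, by omega, Function.iterate_add_apply _ _ _ _⟩

theorem RunsIn.head {t : ℕ} {c c' c'' : Option Q × (∀ k, List (Γ k))}
    (h : windowStep D δ c = c') (h' : RunsIn D δ t c' c'') : RunsIn D δ (t + 1) c c'' :=
  ((RunsIn.single h).trans h').mono (by omega)

/-- In every step the stacks grow at most by the length of the lists that the rule writes. -/
theorem RunsIn.length_le {d : ℕ}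
    (hδ : ∀ q w, (∀ k, (w k).length ≤ D) → ∀ k, ((δ q w).2 k).length ≤ d) {t : ℕ}
    {c c' : Option Q × (∀ k, List (Γ k))} (h : RunsIn D δ t c c') (k : K) :
    (c'.2 k).length ≤ (c.2 k).length + d * t := by
  obtain ⟨s, hs, rfl⟩ := h
  have key : ∀ c : Option Q × (∀ k, List (Γ k)),
      ((windowStep D δ c).2 k).length ≤ (c.2 k).length + d := by
    rintro ⟨_ | q, S⟩
    · exact Nat.le_add_right _ _
    · have h1 := hδ q (fun k => (S k).take D) (fun k => List.length_take_le D (S k)) k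
      simp only [windowStep, List.length_append, List.length_drop]
      omega
  have h2 : (((windowStep D δ)^[s] c).2 k).length ≤ (c.2 k).length + d * s := by
    clear hs
    induction s with
    | zero => simp
    | succ s ih =>
      rw [Function.iterate_succ_apply', mul_add]
      have h3 := key ((windowStep D δ)^[s] c)
      omega
  exact h2.trans (Nat.add_le_add_left (Nat.mul_le_mul_left d hs) _)

end Runs

/-! ### The evaluation machine -/

/-- The names of the stacks: the input, the output, an auxiliary stack, the word, a counter, and
for each coordinate the current value and a copy of the initial value. -/
inductive StackName (n : ℕ) : Type
  | inp
  | out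
  | aux
  | word
  | cnt
  | cur (i : Fin n)
  | ini (i : Fin n)
  deriving DecidableEq, Fintype

/-- The alphabets of the stacks. -/
abbrev StackName.Alph {n : ℕ} (L Out : Type) : StackName n → Type
  | inp => Option Bool ⊕ L
  | out => Out
  | aux => Option Bool
  | word => L
  | cnt => Unit
  | cur _ => Bool
  | ini _ => Bool

instance {n : ℕ} (L Out : Type) [Finite L] [Finite Out] (k : StackName n) :
    Finite (k.Alph L Out) := by
  cases k <;> simp only [StackName.Alph] <;> infer_instance

/-- The contents of all stacks. -/
@[ext] structure Stacks (n : ℕ) (L Out : Type) : Type where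
  inp : List (Option Bool ⊕ L)
  out : List Out
  aux : List (Option Bool)
  word : List L
  cnt : List Unit
  cur : Tup n
  ini : Tup n

namespace Stacks

variable {n : ℕ} {L Out : Type}

/-- The contents as a function of the name of the stack. -/
def get (r : Stacks n L Out) : ∀ k : StackName n, List (k.Alph L Out)
  | .inp => r.inp
  | .out => r.out
  | .aux => r.aux
  | .word => r.word
  | .cnt => r.cnt
  | .cur i => r.cur i
  | .ini i => r.ini i

/-- The inverse of `Stacks.get`. -/
def ofFun (S : ∀ k : StackName n, List (k.Alph L Out)) : Stacks n L Out where
  inp := S .inp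
  out := S .out
  aux := S .aux
  word := S .word
  cnt := S .cnt
  cur := fun i => S (.cur i)
  ini := fun i => S (.ini i)

/-- The topmost `D` symbols of each stack. -/
def take (D : ℕ) (r : Stacks n L Out) : Stacks n L Out where
  inp := r.inp.take D
  out := r.out.take D
  aux := r.aux.take D
  word := r.word.take D
  cnt := r.cnt.take D
  cur := takeTup D r.cur
  ini := takeTup D r.ini

/-- Put the stacks `r` on top of what remains of `s` below the topmost `D` symbols. -/
def onDrop (r : Stacks n L Out) (D : ℕ) (s : Stacks n L Out) : Stacks n L Out where
  inp := r.inp ++ s.inp.drop D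
  out := r.out ++ s.out.drop D
  aux := r.aux ++ s.aux.drop D
  word := r.word ++ s.word.drop D
  cnt := r.cnt ++ s.cnt.drop D
  cur := cat r.cur (dropTup D s.cur)
  ini := cat r.ini (dropTup D s.ini)

/-- Remove the top symbol of each stack but the output. -/
def pop (r : Stacks n L Out) : Stacks n L Out where
  inp := r.inp.tail
  out := r.out
  aux := r.aux.tail
  word := r.word.tail
  cnt := r.cnt.tail
  cur := fun i => (r.cur i).tail
  ini := fun i => (r.ini i).tail

/-- The stacks are empty, the output excepted. -/
def Cleared (r : Stacks n L Out) : Prop :=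
  ∀ k : StackName n, k ≠ .out → r.get k = []

/-- The stacks that hold only an output. -/
def ofOut (l : List Out) : Stacks n L Out where
  inp := []
  out := l
  aux := []
  word := []
  cnt := []
  cur := fun _ => []
  ini := fun _ => []

theorem get_ofOut (l : List Out) :
    (ofOut l : Stacks n L Out).get =
      Function.update (β := fun k : StackName n => List (k.Alph L Out)) (fun _ => []) .out l := by
  funext k
  cases k <;> simp [ofOut, get]

end Stacks

/-- The states of the evaluation machine. In `load` it splits the input into the tuple and the word,
in `dist i` it moves the tuple to the coordinate stacks, where the coordinates from `i` on have been
reached, and in `apply` it applies the word. `collect i` and `flush` write the current tuple to the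
output, where `collect i` has finished the coordinates before `i`; `compare eq` compares the current
tuple with the initial one, where `eq` says whether they agree so far; `clear` empties the stacks
and then writes at most one more symbol. -/
inductive EvalState (n : ℕ) : Type
  | load
  | dist (i : Fin (n + 1))
  | apply
  | collect (i : Fin (n + 1))
  | flush
  | compare (eq : Bool)
  | clear (o : Option (Option Bool))
  deriving Fintype

section Machine

variable {n : ℕ} {L Out : Type}

open Classical in
/-- The rule of the evaluation machine for the morphisms `F`. The counter receives `c` marks per
letter of the word, `emit` translates the output symbols, and `done` or `fail` is the state after
the word has been applied or has turned out to be undefined. -/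
noncomputable def evalRule (F : L → (Tup n ≃. Tup n)) (c : ℕ) (emit : Option Bool → Out)
    (done fail : EvalState n) :
    EvalState n → Stacks n L Out → Option (EvalState n) × Stacks n L Out
  | .load, r =>
    match r.inp with
    | [] => (some (.dist (Fin.last n)), r)
    | .inl s :: l => (some .load, { r with inp := l, aux := s :: r.aux })
    | .inr a :: l => (some .load, { r with
        inp := l, word := a :: r.word, cnt := List.replicate c () ++ r.cnt })
  | .dist i, r =>
    match r.aux with
    | [] => (some .apply, r)
    -- The end marker of a coordinate comes before its symbols, which are read backwards.
    | none :: l => (some (.dist ⟨i - 1, by omega⟩), { r with aux := l })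
    | some b :: l =>
      if h : i < n then
        (some (.dist i), { r with
          aux := l
          cur := Function.update r.cur ⟨i, h⟩ (b :: r.cur ⟨i, h⟩)
          ini := Function.update r.ini ⟨i, h⟩ (b :: r.ini ⟨i, h⟩) })
      else (some (.dist i), { r with aux := l })
  | .apply, r =>
    match r.word with
    | [] => (some done, r)
    | a :: l =>
      match F a r.cur with
      | none => (some fail, { r with word := l })
      | some y => (some .apply, { r with word := l, cur := y })
  | .collect i, r =>
    if h : i < n then
      match r.cur ⟨i, h⟩ with
      | [] => (some (.collect ⟨i + 1, by omega⟩), { r with aux := none :: r.aux })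
      | b :: l => (some (.collect i), { r with
          aux := some b :: r.aux, cur := Function.update r.cur ⟨i, h⟩ l })
    else (some .flush, r)
  | .flush, r =>
    match r.aux with
    | [] => (some (.clear (some none)), r)
    | s :: l => (some .flush, { r with aux := l, out := emit s :: r.out })
  | .compare eq, r =>
    match r.cnt with
    | [] =>
      if ∀ i, r.ini i = [] then (some (.clear (some (some (eq ∧ ∀ i, r.cur i = [])))), r)
      else (some (.clear (some (some true))), r)
    | _ :: l =>
      if ∃ i, r.ini i = [] then (some (.clear (some (some true))), r)
      else (some (.compare (eq ∧ ∀ i, (r.cur i).head? = (r.ini i).head?)), { r with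
          cnt := l
          cur := fun i => (r.cur i).tail
          ini := fun i => (r.ini i).tail })
  | .clear o, r =>
    if r.Cleared then (none, { r with out := (o.map emit).toList ++ r.out })
    else (some (.clear o), r.pop)

/-- The rule of the evaluation machine on the tops of the stacks. -/
noncomputable def evalWindow (F : L → (Tup n ≃. Tup n)) (c : ℕ) (emit : Option Bool → Out)
    (done fail : EvalState n) (q : EvalState n) (w : ∀ k : StackName n, List (k.Alph L Out)) :
    Option (EvalState n) × ∀ k : StackName n, List (k.Alph L Out) :=
  ((evalRule F c emit done fail q (Stacks.ofFun w)).1,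
    (evalRule F c emit done fail q (Stacks.ofFun w)).2.get)

/-- The configuration of the evaluation machine. -/
def evalCfg (q : Option (EvalState n)) (r : Stacks n L Out) :
    Option (EvalState n) × ∀ k : StackName n, List (k.Alph L Out) := (q, r.get)

variable {F : L → (Tup n ≃. Tup n)} {c : ℕ} {emit : Option Bool → Out} {done fail : EvalState n}
  {D : ℕ}

/-- The effect of one step, with `r'` the new tops and `r''` the new stacks. -/
theorem windowStep_evalWindow (q : EvalState n) (r : Stacks n L Out) {q' r' r''}
    (h : evalRule F c emit done fail q (r.take D) = (q', r')) (h' : r'.onDrop D r = r'') :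
    windowStep D (evalWindow F c emit done fail) (evalCfg (some q) r) = evalCfg q' r'' := by
  have h1 : Stacks.ofFun (fun k => (r.get k).take D) = r.take D := rfl
  subst h'
  simp only [windowStep, evalCfg, evalWindow, h1, h]
  refine Prod.ext rfl (funext fun k => ?_)
  cases k <;> rfl

theorem Stacks.take_onDrop (r : Stacks n L Out) : (r.take D).onDrop D r = r := by
  ext1 <;> simp [Stacks.take, Stacks.onDrop, cat_take_drop]

end Machine

/-! ### The phases of a run -/

section Phases

variable {n : ℕ} {L Out : Type} {F : L → (Tup n ≃. Tup n)} {c : ℕ} {emit : Option Bool → Out}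
  {done fail : EvalState n} {D : ℕ} {inp : List (Option Bool ⊕ L)} {out : List Out}
  {aux : List (Option Bool)} {word : List L} {cnt : List Unit} {cur ini : Tup n}

/-- Moving the word reverses it, so that its last letter, which acts first, comes to the top. -/
theorem runsIn_load_word (w : List L) : ∀ (word : List L) (m : ℕ),
    RunsIn (D + 1) (evalWindow F c emit done fail) w.length
      (evalCfg (some .load) ⟨w.map .inr, out, aux, word, List.replicate m (), cur, ini⟩)
      (evalCfg (some .load)
        ⟨[], out, aux, w.reverse ++ word, List.replicate (c * w.length + m) (), cur, ini⟩) := by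
  induction w with
  | nil => intro word m; simpa using RunsIn.refl _
  | cons a w ih =>
    intro word m
    refine RunsIn.head (windowStep_evalWindow .load _ rfl
      (r'' := ⟨w.map .inr, out, aux, a :: word, List.replicate (c + m) (), cur, ini⟩) ?_) ?_
    · simp [Stacks.onDrop, Stacks.take, cat_take_drop]
      omega
    · have hc : c * (a :: w).length + m = c * w.length + (c + m) := by
        rw [List.length_cons]; ring
      rw [hc]
      convert ih (a :: word) (c + m) using 3
      simp

theorem runsIn_load_tuple (u : List (Option Bool)) (l : List (Option Bool ⊕ L)) :
    ∀ aux, RunsIn (D + 1) (evalWindow F c emit done fail) u.length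
      (evalCfg (some .load) ⟨u.map .inl ++ l, out, aux, word, cnt, cur, ini⟩)
      (evalCfg (some .load) ⟨l, out, u.reverse ++ aux, word, cnt, cur, ini⟩) := by
  induction u with
  | nil => intro aux; exact RunsIn.refl _
  | cons s u ih =>
    intro aux
    refine RunsIn.head (windowStep_evalWindow .load _ rfl
      (r'' := ⟨u.map .inl ++ l, out, s :: aux, word, cnt, cur, ini⟩) ?_) ?_
    · simp [Stacks.onDrop, Stacks.take, cat_take_drop]
    · convert ih (s :: aux) using 3
      simp

/-- The coordinates from `i` on; the other ones are made empty. -/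
def lastCoords {n : ℕ} (i : ℕ) (x : Tup n) : Tup n := fun j => if i ≤ j then x j else []

/-- The part of `encTup x` that encodes the coordinates from `i` on. -/
def encLast {n : ℕ} (i : ℕ) (x : Tup n) : List (Option Bool) :=
  ((List.ofFn fun i => (x i).map some ++ [none]).drop i).flatten

theorem encLast_zero (x : Tup n) : encLast 0 x = encTup x := rfl

theorem encLast_self (x : Tup n) : encLast n x = [] := by
  rw [encLast, List.drop_of_length_le (by simp)]; rfl

theorem encLast_eq (x : Tup n) (i : Fin n) :
    encLast i x = (x i).map some ++ none :: encLast (i + 1) x := by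
  rw [encLast, encLast, List.drop_eq_getElem_cons (by simp)]
  simp

theorem lastCoords_self (x : Tup n) : lastCoords n x = fun _ => [] := by
  funext j; simp [lastCoords]

theorem lastCoords_zero (x : Tup n) : lastCoords 0 x = x := by
  funext j; simp [lastCoords]

theorem lastCoords_eq_update (x : Tup n) (i : Fin n) :
    lastCoords i x = Function.update (lastCoords (i + 1) x) i (x i) := by
  funext j
  by_cases h : j = i
  · subst h; simp [lastCoords]
  · have h' : (j : ℕ) ≠ i := fun h' => h (Fin.ext h')
    have : (i : ℕ) ≤ j ↔ (i : ℕ) + 1 ≤ j := by omega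
    simp [lastCoords, h, this]

theorem lastCoords_succ_eq_update (x : Tup n) (i : Fin n) :
    lastCoords (i + 1) x = Function.update (lastCoords i x) i [] := by
  rw [lastCoords_eq_update, Function.update_idem, eq_comm, Function.update_eq_self_iff]
  simp [lastCoords]

theorem length_encTup (x : Tup n) : (encTup x).length = ∑ i, ((x i).length + 1) := by
  simp [encTup, List.sum_ofFn, Function.comp_def]

theorem update_cat_drop (N : ℕ) (x : Tup n) (j : Fin n) (u : List Bool) :
    cat (Function.update (takeTup N x) j u) (dropTup N x) =
      Function.update x j (u ++ (x j).drop N) := by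
  funext i
  by_cases h : i = j
  · subst h; simp [cat, dropTup]
  · simp [cat, dropTup, takeTup, h]

/-- The auxiliary stack holds the input tuple in reverse, so that the coordinates are restored in
their original order, beginning with their last symbols. -/
theorem runsIn_dist_bits (j : Fin n) (l : List Bool) :
    ∀ (aux : List (Option Bool)) (cur ini : Tup n),
    RunsIn (D + 1) (evalWindow F c emit done fail) l.length
      (evalCfg (some (.dist j.castSucc))
        ⟨inp, out, (l.map some).reverse ++ aux, word, cnt, cur, ini⟩)
      (evalCfg (some (.dist j.castSucc)) ⟨inp, out, aux, word, cnt,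
        Function.update cur j (l ++ cur j), Function.update ini j (l ++ ini j)⟩) := by
  induction l using List.reverseRecOn with
  | nil => intro aux cur ini; simpa using RunsIn.refl _
  | append_singleton l b ih =>
    intro aux cur ini
    rw [List.length_append]
    refine RunsIn.head (windowStep_evalWindow (.dist j.castSucc) _ (q' := some (.dist j.castSucc))
      (r' := ⟨inp.take (D + 1), out.take (D + 1), ((l.map some).reverse ++ aux).take D,
        word.take (D + 1), cnt.take (D + 1),
        Function.update (takeTup (D + 1) cur) j (b :: takeTup (D + 1) cur j),
        Function.update (takeTup (D + 1) ini) j (b :: takeTup (D + 1) ini j)⟩)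
      (r'' := ⟨inp, out, (l.map some).reverse ++ aux, word, cnt,
        Function.update cur j (b :: cur j), Function.update ini j (b :: ini j)⟩) ?_ ?_) ?_
    · simp [evalRule, Stacks.take]
    · simp only [Stacks.onDrop, update_cat_drop]
      simp [takeTup]
    · convert ih aux _ _ using 3 <;> simp

theorem runsIn_dist (x : Tup n) {i : ℕ} (hi : i ≤ n) : ∀ aux : List (Option Bool),
    RunsIn (D + 1) (evalWindow F c emit done fail) (encLast i x).length
      (evalCfg (some (.dist (Fin.last n)))
        ⟨inp, out, (encLast i x).reverse ++ aux, word, cnt, fun _ => [], fun _ => []⟩)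
      (evalCfg (some (.dist ⟨i, by omega⟩))
        ⟨inp, out, aux, word, cnt, lastCoords i x, lastCoords i x⟩) := by
  induction hi using Nat.decreasingInduction with
  | self =>
    intro aux
    rw [encLast_self, lastCoords_self]
    exact RunsIn.refl _
  | of_succ i hi ih =>
    intro aux
    have h1 := encLast_eq x ⟨i, hi⟩
    have h2 := lastCoords_eq_update x ⟨i, hi⟩
    dsimp only at h1 h2
    have h3 : lastCoords (i + 1) x ⟨i, hi⟩ = [] := by simp [lastCoords]
    rw [h1, h2]
    have h4 := ih (none :: (((x ⟨i, hi⟩).map some).reverse ++ aux))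
    have h5 := runsIn_dist_bits (D := D) (F := F) (c := c) (emit := emit) (done := done)
      (fail := fail) (inp := inp) (out := out) (word := word) (cnt := cnt) ⟨i, hi⟩ (x ⟨i, hi⟩) aux
      (lastCoords (i + 1) x) (lastCoords (i + 1) x)
    rw [h3, List.append_nil] at h5
    have h6 := h4.trans (RunsIn.head (windowStep_evalWindow _ _ rfl
      (r'' := ⟨inp, out, ((x ⟨i, hi⟩).map some).reverse ++ aux, word, cnt, lastCoords (i + 1) x,
        lastCoords (i + 1) x⟩)
      (by simp [Stacks.onDrop, Stacks.take, cat_take_drop])) h5)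
    simp only [List.reverse_append, List.reverse_cons, List.append_assoc, List.singleton_append]
    refine h6.mono ?_
    simp only [List.length_append, List.length_map, List.length_cons]
    omega

theorem takeTup_eq_nil_iff (x : Tup n) (i : Fin n) : takeTup (D + 1) x i = [] ↔ x i = [] := by
  simp [takeTup]

theorem head?_takeTup (x : Tup n) (i : Fin n) : (takeTup (D + 1) x i).head? = (x i).head? := by
  cases h : x i <;> simp [takeTup, h]

theorem tail_take_append_drop {A : Type} (l : List A) :
    (l.take (D + 1)).tail ++ l.drop (D + 1) = l.tail := by
  cases l <;> simp

theorem cat_tail_takeTup (x : Tup n) :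
    cat (fun i => (takeTup (D + 1) x i).tail) (dropTup (D + 1) x) = fun i => (x i).tail :=
  funext fun _ => tail_take_append_drop _

/-- By `hF` a letter acts on the tops of the current stacks, so that each letter takes one step. -/
theorem runsIn_apply (hF : ∀ a x, F a x =
      (F a (takeTup (D + 1) x)).map fun z => cat z (dropTup (D + 1) x)) (w : List L) :
    ∀ x : Tup n,
      (∀ y, wordFun F w x = some y →
        RunsIn (D + 1) (evalWindow F c emit done fail) (w.length + 1)
          (evalCfg (some .apply) ⟨inp, out, aux, w.reverse, cnt, x, ini⟩)
          (evalCfg (some done) ⟨inp, out, aux, [], cnt, y, ini⟩)) ∧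
      (wordFun F w x = none → ∃ v z,
        RunsIn (D + 1) (evalWindow F c emit done fail) (w.length + 1)
          (evalCfg (some .apply) ⟨inp, out, aux, w.reverse, cnt, x, ini⟩)
          (evalCfg (some fail) ⟨inp, out, aux, v, cnt, z, ini⟩)) := by
  induction w using List.reverseRecOn with
  | nil =>
    refine fun x => ⟨fun y hy => ?_, fun h => absurd h (by simp [wordFun])⟩
    obtain rfl : x = y := Option.some.inj hy
    exact RunsIn.single (windowStep_evalWindow _ _ rfl (Stacks.take_onDrop _))
  | append_singleton w a ih =>
    intro x
    rw [wordFun_append, wordFun_singleton, hF a x, List.reverse_append, List.length_append]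
    cases hz : F a (takeTup (D + 1) x) with
    | none =>
      refine ⟨fun y hy => absurd hy (by simp), fun _ => ⟨w.reverse, x, ?_⟩⟩
      refine (RunsIn.single (windowStep_evalWindow (.apply) _ (q' := some fail)
        (r' := ⟨inp.take (D + 1), out.take (D + 1), aux.take (D + 1), w.reverse.take D,
          cnt.take (D + 1), takeTup (D + 1) x, takeTup (D + 1) ini⟩) ?_ ?_)).mono (by omega)
      · simp [evalRule, Stacks.take, hz]
      · simp [Stacks.onDrop, cat_take_drop]
    | some z =>
      have hstep : windowStep (D + 1) (evalWindow F c emit done fail)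
          (evalCfg (some .apply) ⟨inp, out, aux, [a].reverse ++ w.reverse, cnt, x, ini⟩) =
          evalCfg (some .apply)
            ⟨inp, out, aux, w.reverse, cnt, cat z (dropTup (D + 1) x), ini⟩ := by
        refine windowStep_evalWindow (.apply) _
          (r' := ⟨inp.take (D + 1), out.take (D + 1), aux.take (D + 1), w.reverse.take D,
            cnt.take (D + 1), z, takeTup (D + 1) ini⟩) ?_ ?_
        · simp [evalRule, Stacks.take, hz]
        · simp [Stacks.onDrop, cat_take_drop]
      obtain ⟨ih1, ih2⟩ := ih (cat z (dropTup (D + 1) x))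
      refine ⟨fun y hy => RunsIn.head hstep (ih1 y hy), fun h => ?_⟩
      obtain ⟨v, z', hv⟩ := ih2 h
      exact ⟨v, z', RunsIn.head hstep hv⟩

theorem runsIn_collect_bits (j : Fin n) (l : List Bool) :
    ∀ (aux : List (Option Bool)) (cur : Tup n), cur j = l →
      RunsIn (D + 1) (evalWindow F c emit done fail) l.length
        (evalCfg (some (.collect j.castSucc)) ⟨inp, out, aux, word, cnt, cur, ini⟩)
        (evalCfg (some (.collect j.castSucc))
          ⟨inp, out, (l.map some).reverse ++ aux, word, cnt, Function.update cur j [], ini⟩) := by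
  induction l with
  | nil =>
    intro aux cur h
    rw [Function.update_eq_self_iff.2 h.symm]
    exact RunsIn.refl _
  | cons b l ih =>
    intro aux cur h
    refine RunsIn.head (windowStep_evalWindow (.collect j.castSucc) _
      (q' := some (.collect j.castSucc))
      (r' := ⟨inp.take (D + 1), out.take (D + 1), some b :: aux.take (D + 1),
        word.take (D + 1), cnt.take (D + 1),
        Function.update (takeTup (D + 1) cur) j (l.take D), takeTup (D + 1) ini⟩)
      (r'' := ⟨inp, out, some b :: aux, word, cnt, Function.update cur j l, ini⟩) ?_ ?_) ?_
    · simp [evalRule, Stacks.take, takeTup, h]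
    · simp only [Stacks.onDrop, update_cat_drop, cat_take_drop]
      simp [h]
    · convert ih (some b :: aux) (Function.update cur j l) (by simp) using 3 <;> simp

theorem runsIn_collect (x : Tup n) {i : ℕ} (hi : i ≤ n) : ∀ aux : List (Option Bool),
    RunsIn (D + 1) (evalWindow F c emit done fail) ((encLast i x).length + 1)
      (evalCfg (some (.collect ⟨i, by omega⟩))
        ⟨inp, out, aux, word, cnt, lastCoords i x, ini⟩)
      (evalCfg (some .flush)
        ⟨inp, out, (encLast i x).reverse ++ aux, word, cnt, fun _ => [], ini⟩) := by
  induction hi using Nat.decreasingInduction with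
  | self =>
    intro aux
    rw [encLast_self, lastCoords_self]
    refine RunsIn.single (windowStep_evalWindow _ _ (q' := some .flush) (r' := Stacks.take (D + 1)
      ⟨inp, out, aux, word, cnt, fun _ => [], ini⟩) ?_ (Stacks.take_onDrop _))
    simp [evalRule]
  | of_succ i hi ih =>
    intro aux
    have h1 := encLast_eq x ⟨i, hi⟩
    have h2 := lastCoords_succ_eq_update x ⟨i, hi⟩
    dsimp only at h1 h2
    have h4 := ih (none :: (((x ⟨i, hi⟩).map some).reverse ++ aux))
    have h5 := runsIn_collect_bits (D := D) (F := F) (c := c) (emit := emit) (done := done)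
      (fail := fail) (inp := inp) (out := out) (word := word) (cnt := cnt) (ini := ini) ⟨i, hi⟩
      (x ⟨i, hi⟩) aux (lastCoords i x) (by simp [lastCoords])
    rw [← h2] at h5
    have h6 := h5.trans (RunsIn.head (windowStep_evalWindow _ _
      (q' := some (.collect ⟨i + 1, by omega⟩))
      (r' := { Stacks.take (D + 1) ⟨inp, out, ((x ⟨i, hi⟩).map some).reverse ++ aux, word, cnt,
        lastCoords (i + 1) x, ini⟩ with
          aux := none :: (((x ⟨i, hi⟩).map some).reverse ++ aux).take (D + 1) })
      (r'' := ⟨inp, out, none :: (((x ⟨i, hi⟩).map some).reverse ++ aux), word, cnt,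
        lastCoords (i + 1) x, ini⟩)
      (by simp [evalRule, Stacks.take, takeTup, lastCoords, hi])
      (by simp [Stacks.onDrop, Stacks.take, cat_take_drop])) h4)
    simp only [h1, List.reverse_append, List.reverse_cons, List.append_assoc,
      List.singleton_append]
    refine h6.mono ?_
    simp only [List.length_append, List.length_map, List.length_cons]
    omega

theorem runsIn_flush (aux : List (Option Bool)) : ∀ out : List Out,
    RunsIn (D + 1) (evalWindow F c emit done fail) (aux.length + 1)
      (evalCfg (some .flush) ⟨inp, out, aux, word, cnt, cur, ini⟩)
      (evalCfg (some (.clear (some none)))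
        ⟨inp, aux.reverse.map emit ++ out, [], word, cnt, cur, ini⟩) := by
  induction aux with
  | nil => exact fun out =>
      RunsIn.single (windowStep_evalWindow _ _ rfl (Stacks.take_onDrop _))
  | cons s aux ih =>
    intro out
    refine RunsIn.head (windowStep_evalWindow .flush _ rfl
      (r'' := ⟨inp, emit s :: out, aux, word, cnt, cur, ini⟩) ?_) ?_
    · simp [Stacks.onDrop, Stacks.take, cat_take_drop]
    · have h1 : (s :: aux).reverse.map emit ++ out = aux.reverse.map emit ++ emit s :: out := by
        simp
      rw [h1]
      exact ih (emit s :: out)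

theorem tup_eq_iff_head?_tail {x y : Tup n} : x = y ↔
    (∀ i, (x i).head? = (y i).head?) ∧ (fun i => (x i).tail) = fun i => (y i).tail := by
  constructor
  · rintro rfl; exact ⟨fun _ => rfl, rfl⟩
  · rintro ⟨h1, h2⟩
    funext i
    have h1 := h1 i
    have h2 := congrFun h2 i
    cases hx : x i <;> cases hy : y i <;> simp_all

open Classical in
/-- The comparison popped in lockstep from the counter, the current and the initial tuple tells
whether the initial tuple has coordinates as long as the counter, and whether it is the current
one. -/
theorem runsIn_compare (m : ℕ) : ∀ (eq : Bool) (cur ini : Tup n), ∃ cnt' cur' ini',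
    RunsIn (D + 1) (evalWindow F c emit done fail) (m + 1)
      (evalCfg (some (.compare eq)) ⟨inp, out, aux, word, List.replicate m (), cur, ini⟩)
      (evalCfg (some (.clear (some (some
          (decide ((∀ i, (ini i).length = m) → eq = true ∧ cur = ini))))))
        ⟨inp, out, aux, word, cnt', cur', ini'⟩) := by
  induction m with
  | zero =>
    intro eq cur ini
    refine ⟨[], cur, ini, RunsIn.single (windowStep_evalWindow _ _
      (r' := Stacks.take (D + 1) ⟨inp, out, aux, word, [], cur, ini⟩) ?_ (Stacks.take_onDrop _))⟩
    by_cases h : ∀ i, ini i = []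
    · obtain rfl : ini = fun _ => [] := funext h
      simp [evalRule, Stacks.take, takeTup_eq_nil_iff, funext_iff]
    · simp [evalRule, Stacks.take, takeTup_eq_nil_iff, h]
  | succ m ih =>
    intro eq cur ini
    by_cases h : ∃ i, ini i = []
    · refine ⟨List.replicate (m + 1) (), cur, ini, (RunsIn.single (windowStep_evalWindow _ _
        (r' := Stacks.take (D + 1) ⟨inp, out, aux, word, List.replicate (m + 1) (), cur, ini⟩) ?_
          (Stacks.take_onDrop _))).mono (by omega)⟩
      have h' : ¬ ∀ i, (ini i).length = m + 1 := fun h' => by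
        obtain ⟨i, hi⟩ := h
        have := h' i
        simp [hi] at this
      simp [evalRule, Stacks.take, takeTup_eq_nil_iff, h, h', List.replicate_succ]
    · obtain ⟨cnt', cur', ini', h1⟩ := ih (eq ∧ ∀ i, (cur i).head? = (ini i).head?)
        (fun i => (cur i).tail) (fun i => (ini i).tail)
      refine ⟨cnt', cur', ini', RunsIn.head (windowStep_evalWindow _ _
        (q' := some (.compare (eq ∧ ∀ i, (cur i).head? = (ini i).head?)))
        (r' := ⟨inp.take (D + 1), out.take (D + 1), aux.take (D + 1), word.take (D + 1),
          (List.replicate m ()).take D, fun i => (takeTup (D + 1) cur i).tail,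
          fun i => (takeTup (D + 1) ini i).tail⟩)
        (r'' := ⟨inp, out, aux, word, List.replicate m (), fun i => (cur i).tail,
          fun i => (ini i).tail⟩) ?_ ?_) ?_⟩
      · simp [evalRule, Stacks.take, takeTup_eq_nil_iff, h, List.replicate_succ, head?_takeTup]
      · simp only [Stacks.onDrop, cat_tail_takeTup]
        simp [List.replicate_succ, -List.take_replicate, -List.drop_replicate]
      · convert h1 using 6
        have h2 : (∀ i, ((ini i).tail).length = m) ↔ ∀ i, (ini i).length = m + 1 :=
          forall_congr' fun i => by
            have : ini i ≠ [] := fun h' => h ⟨i, h'⟩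
            cases hi : ini i with
            | nil => exact absurd hi this
            | cons b l => simp
        rw [decide_eq_decide, h2, tup_eq_iff_head?_tail (x := cur)]
        simp [and_assoc]

theorem Stacks.cleared_take (r : Stacks n L Out) : (r.take (D + 1)).Cleared ↔ r.Cleared := by
  refine forall_congr' fun k => imp_congr_right fun _ => ?_
  cases k <;> simp [Stacks.take, Stacks.get, takeTup_eq_nil_iff]

theorem Stacks.get_pop (r : Stacks n L Out) {k : StackName n} (hk : k ≠ .out) :
    r.pop.get k = (r.get k).tail := by
  cases k <;> first | rfl | exact absurd rfl hk

theorem Stacks.Cleared.eq_ofOut {r : Stacks n L Out} (h : r.Cleared) : r = ofOut r.out := by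
  ext1
  · exact h .inp (by simp)
  · rfl
  · exact h .aux (by simp)
  · exact h .word (by simp)
  · exact h .cnt (by simp)
  · exact funext fun i => h (.cur i) (by simp)
  · exact funext fun i => h (.ini i) (by simp)

/-- The stacks are popped in parallel, so that the longest one determines the time. -/
theorem runsIn_clear (o : Option (Option Bool)) (m : ℕ) : ∀ r : Stacks n L Out,
    (∀ k : StackName n, k ≠ .out → (r.get k).length ≤ m) →
      RunsIn (D + 1) (evalWindow F c emit done fail) (m + 1) (evalCfg (some (.clear o)) r)
        (evalCfg none (Stacks.ofOut ((o.map emit).toList ++ r.out))) := by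
  have hc : ∀ r : Stacks n L Out, r.Cleared →
      RunsIn (D + 1) (evalWindow F c emit done fail) 1 (evalCfg (some (.clear o)) r)
        (evalCfg none (Stacks.ofOut ((o.map emit).toList ++ r.out))) := by
    intro r h
    refine RunsIn.single (windowStep_evalWindow _ _ (q' := none)
      (r' := { r.take (D + 1) with out := (o.map emit).toList ++ r.out.take (D + 1) }) ?_ ?_)
    · exact if_pos (r.cleared_take.2 h)
    · rw [h.eq_ofOut]
      simp [Stacks.ofOut, Stacks.onDrop, Stacks.take, cat_take_drop]
  intro r hr
  induction m generalizing r with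
  | zero => exact hc r fun k hk => List.eq_nil_of_length_eq_zero (Nat.le_zero.1 (hr k hk))
  | succ m ih =>
    by_cases h : r.Cleared
    · exact (hc r h).mono (by omega)
    · refine RunsIn.head (windowStep_evalWindow _ _ (q' := some (.clear o))
        (r' := (r.take (D + 1)).pop) (r'' := r.pop) ?_ ?_) (ih r.pop fun k hk => ?_)
      · exact if_neg (mt r.cleared_take.1 h)
      · simp only [Stacks.onDrop, Stacks.pop, Stacks.take, tail_take_append_drop,
          cat_tail_takeTup, List.take_append_drop]
      · rw [Stacks.get_pop r hk, List.length_tail]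
        exact Nat.sub_le_of_le_add (hr k hk)

end Phases

/-! ### Polynomial time -/

section Final

variable {n : ℕ} {L Out : Type} {F : L → (Tup n ≃. Tup n)} {c : ℕ} {emit : Option Bool → Out}
  {done fail : EvalState n} {D : ℕ}

/-- The initial configuration. -/
def evalStart (Out : Type) (p : Tup n × List L) :
    Option (EvalState n) × ∀ k : StackName n, List (k.Alph L Out) :=
  evalCfg (some .load) ⟨encPair p, [], [], [], [], fun _ => [], fun _ => []⟩

theorem evalStart_eq (p : Tup n × List L) : evalStart Out p = (some .load,
    Function.update (β := fun k : StackName n => List (k.Alph L Out)) (fun _ => []) .inp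
      (encPair p)) := by
  refine Prod.ext rfl (funext fun k => ?_)
  cases k <;> simp [evalStart, evalCfg, Stacks.get]

theorem runsIn_evalStart_apply (x : Tup n) (w : List L) :
    RunsIn (D + 1) (evalWindow F c emit done fail) (2 * (encPair (x, w)).length + 2)
      (evalStart Out (x, w))
      (evalCfg (some .apply)
        ⟨[], [], [], w.reverse, List.replicate (c * w.length) (), x, x⟩) := by
  have h1 := runsIn_load_tuple (D := D) (F := F) (c := c) (emit := emit) (done := done)
    (fail := fail) (out := []) (word := []) (cnt := []) (cur := fun _ => [])
    (ini := fun _ => []) (encTup x) (w.map .inr) []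
  have h2 := runsIn_load_word (D := D) (F := F) (c := c) (emit := emit) (done := done)
    (fail := fail) (out := []) (aux := (encTup x).reverse ++ []) (cur := fun _ => [])
    (ini := fun _ => []) w [] 0
  have h3 := runsIn_dist (D := D) (F := F) (c := c) (emit := emit) (done := done)
    (fail := fail) (inp := []) (out := []) (word := w.reverse ++ [])
    (cnt := List.replicate (c * w.length + 0) ()) x (Nat.zero_le n) []
  rw [encLast_zero, lastCoords_zero] at h3
  have h4 := ((h1.trans h2).trans
    (RunsIn.head (windowStep_evalWindow _ _ rfl (Stacks.take_onDrop _)) h3)).trans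
    (RunsIn.single (windowStep_evalWindow _ _ rfl (Stacks.take_onDrop _)))
  simp only [List.append_nil, add_zero] at h4
  refine h4.mono ?_
  simp only [encPair, List.length_append, List.length_map]
  omega

/-- The machine applies the word in linear time. -/
theorem runsIn_evalStart (hF : ∀ a x, F a x =
      (F a (takeTup (D + 1) x)).map fun z => cat z (dropTup (D + 1) x)) (x : Tup n) (w : List L) :
    (∀ y, wordFun F w x = some y →
      RunsIn (D + 1) (evalWindow F c emit done fail) (3 * (encPair (x, w)).length + 3)
        (evalStart Out (x, w))
        (evalCfg (some done) ⟨[], [], [], [], List.replicate (c * w.length) (), y, x⟩)) ∧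
    (wordFun F w x = none → ∃ v z,
      RunsIn (D + 1) (evalWindow F c emit done fail) (3 * (encPair (x, w)).length + 3)
        (evalStart Out (x, w))
        (evalCfg (some fail) ⟨[], [], [], v, List.replicate (c * w.length) (), z, x⟩)) := by
  have h1 := runsIn_evalStart_apply (D := D) (F := F) (c := c) (emit := emit) (done := done)
    (fail := fail) x w
  obtain ⟨h2, h3⟩ := runsIn_apply (c := c) (emit := emit) (done := done) (fail := fail)
    (inp := []) (out := []) (aux := []) (cnt := List.replicate (c * w.length) ()) (ini := x) hF w x
  have hN : w.length ≤ (encPair (x, w)).length := by simp [encPair]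
  refine ⟨fun y hy => (h1.trans (h2 y hy)).mono (by omega), fun h => ?_⟩
  obtain ⟨v, z, h4⟩ := h3 h
  exact ⟨v, z, (h1.trans h4).mono (by omega)⟩

theorem length_evalStart_le (p : Tup n × List L) (k : StackName n) :
    ((evalStart Out p).2 k).length ≤ (encPair p).length := by
  cases k <;> simp [evalStart, evalCfg, Stacks.get]

/-- Emptying the stacks takes no longer than filling them has taken, up to a constant factor. -/
theorem runsIn_halt {d : ℕ} (hd : ∀ q w, (∀ k, (w k).length ≤ D + 1) →
      ∀ k, ((evalWindow F c emit done fail q w).2 k).length ≤ d)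
    {p : Tup n × List L} {t : ℕ} {o : Option (Option Bool)} {r : Stacks n L Out}
    (h : RunsIn (D + 1) (evalWindow F c emit done fail) t (evalStart Out p)
      (evalCfg (some (.clear o)) r)) :
    RunsIn (D + 1) (evalWindow F c emit done fail) (t + ((encPair p).length + d * t + 1))
      (evalStart Out p) (evalCfg none (Stacks.ofOut ((o.map emit).toList ++ r.out))) :=
  h.trans (runsIn_clear o _ r fun k _ =>
    (h.length_le hd k).trans (Nat.add_le_add_right (length_evalStart_le p k) _))

/-- If the machine reaches the state `clear` in polynomial time, then it computes in polynomial
time. -/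
theorem computableInPolyTime_of_runsIn [Finite L] [Finite Out] {β : Type} (eb : β → List Out)
    (f : Tup n × List L → β) (T : ℕ → Polynomial ℕ)
    (h : ∀ d, (∀ q w, (∀ k, (w k).length ≤ D + 1) →
        ∀ k, ((evalWindow F c emit done fail q w).2 k).length ≤ d) →
      ∀ p, ∃ o r, (o.map emit).toList ++ r.out = eb (f p) ∧
        RunsIn (D + 1) (evalWindow F c emit done fail) ((T d).eval (encPair p).length)
          (evalStart Out p) (evalCfg (some (.clear o)) r)) :
    Nonempty (Turing.TM2ComputableInPolyTime (encPair (m := n) (L := L)) eb f) := by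
  have : Finite (EvalState n) := Finite.of_fintype _
  obtain ⟨d, -, hd⟩ := exists_length_rule_le (D + 1)
    (evalWindow (Out := Out) F c emit done fail)
  refine computableInPolyTime_of_window (Γ := StackName.Alph (n := n) L Out)
    (k₀ := .inp) (k₁ := .out) encPair eb f (D + 1) .load (evalWindow F c emit done fail)
    (T d + (Polynomial.X + Polynomial.C d * T d + 1)) fun p => ?_
  obtain ⟨o, r, ho, hr⟩ := h d hd p
  obtain ⟨t, ht, hrun⟩ := runsIn_halt hd hr
  refine ⟨t, ?_, ?_⟩
  · simpa using ht
  · rw [evalStart_eq, ho] at hrun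
    rw [hrun, evalCfg, Stacks.get_ofOut]

/-- The bounds on the growth of the stacks also bound the length of the output. -/
theorem evalInPolyTime_of_takeTup [Finite L] (hF : ∀ a x, F a x =
      (F a (takeTup (D + 1) x)).map fun z => cat z (dropTup (D + 1) x)) : EvalInPolyTime F := by
  -- The encoded output consists of `n` coordinates with end markers, each at most as long as a stack
  -- can be by then, and it is moved twice.
  refine computableInPolyTime_of_runsIn (D := D) (c := 0) (emit := id) (F := F)
    (done := .collect 0) (fail := .clear none) encOpt _
    (fun d => 3 * Polynomial.X + 3 + 2 * (Polynomial.C n *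
      (Polynomial.X + Polynomial.C d * (3 * Polynomial.X + 3) + 1) + 1)) ?_
  rintro d hd ⟨x, w⟩
  obtain ⟨h1, h2⟩ := runsIn_evalStart (c := 0) (emit := id) (done := .collect 0)
    (fail := .clear none) hF x w
  cases hxw : wordFun F w x with
  | none =>
    obtain ⟨v, z, h3⟩ := h2 hxw
    refine ⟨none, _, ?_, h3.mono ?_⟩
    · simp [encOpt]
    · simp
  | some y =>
    have h3 := h1 y hxw
    have hy : ∀ i, (y i).length ≤ (encPair (x, w)).length +
        d * (3 * (encPair (x, w)).length + 3) := fun i =>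
      (h3.length_le hd (.cur i)).trans
        (Nat.add_le_add_right (length_evalStart_le _ _) _)
    have hlen : (encTup y).length ≤ n * ((encPair (x, w)).length +
        d * (3 * (encPair (x, w)).length + 3) + 1) := by
      rw [length_encTup]
      refine (Finset.sum_le_card_nsmul _ _ _ fun i _ => Nat.add_le_add_right (hy i) 1).trans ?_
      simp
    have h4 := runsIn_collect (D := D) (F := F) (c := 0) (emit := id) (done := .collect 0)
      (fail := .clear none) (inp := []) (out := []) (word := [])
      (cnt := List.replicate (0 * w.length) ()) (ini := x) y (Nat.zero_le n) []
    rw [encLast_zero, lastCoords_zero, List.append_nil] at h4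
    have h5 := runsIn_flush (D := D) (F := F) (c := 0) (emit := id) (done := .collect 0)
      (fail := .clear none) (inp := []) (word := []) (cnt := List.replicate (0 * w.length) ())
      (cur := fun _ => []) (ini := x) (encTup y).reverse []
    refine ⟨_, _, ?_, ((h3.trans h4).trans h5).mono ?_⟩
    · simp [encOpt]
    · rw [List.length_reverse]
      simp
      omega

/-- The counter holds `c` marks per letter, so that the lengths can be compared in unary. An
undefined value is treated as one that differs from the initial tuple. -/
theorem inP_of_takeTup [Finite L] (hF : ∀ a x, F a x =
      (F a (takeTup (D + 1) x)).map fun z => cat z (dropTup (D + 1) x)) (c : ℕ) :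
    InP fun (x : Tup n) (w : List L) =>
      (∀ i, (x i).length = c * w.length) → wordFun F w x = some x := by
  classical
  refine computableInPolyTime_of_runsIn (D := D) (c := c) (emit := fun s => s.getD false) (F := F)
    (done := .compare true) (fail := .compare false) _ _
    (fun d => 3 * Polynomial.X + 3 + (Polynomial.C c * Polynomial.X + 1)) ?_
  rintro d hd ⟨x, w⟩
  obtain ⟨h1, h2⟩ := runsIn_evalStart (c := c) (emit := fun s => s.getD false)
    (done := .compare true) (fail := .compare false) hF x w
  have hN : c * w.length ≤ c * (encPair (x, w)).length :=
    Nat.mul_le_mul_left c (by simp [encPair])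
  cases hxw : wordFun F w x with
  | none =>
    obtain ⟨v, z, h3⟩ := h2 hxw
    obtain ⟨cnt', cur', ini', h4⟩ := runsIn_compare (D := D) (F := F) (c := c)
      (emit := fun s => s.getD false) (done := .compare true) (fail := .compare false) (inp := [])
      (out := []) (aux := []) (word := v) (c * w.length) false z x
    refine ⟨_, _, ?_, (h3.trans h4).mono ?_⟩
    · simp [Computability.encodeBool, hxw]
    · simpa using hN
  | some y =>
    obtain ⟨cnt', cur', ini', h4⟩ := runsIn_compare (D := D) (F := F) (c := c)
      (emit := fun s => s.getD false) (done := .compare true) (fail := .compare false) (inp := [])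
      (out := []) (aux := []) (word := []) (c * w.length) true y x
    refine ⟨_, _, ?_, ((h1 y hxw).trans h4).mono ?_⟩
    · simp [Computability.encodeBool, hxw]
    · simpa using hN

end Final

/-! ### The word problem -/

section Main

variable {n : ℕ} {S : Set (nV n)} {F : Letter S → (Tup n ≃. Tup n)}

/-- The number of symbols read is taken to be positive, as every phase of the machine reads at least
the top symbols of its stacks. -/
theorem apply_eq_map_takeTup_maxEll [Finite (Letter S)] (hF : IsTableChoice F) (a : Letter S)
    (x : Tup n) : F a x = (F a (takeTup (maxEll F + 1) x)).map
      fun z => cat z (dropTup (maxEll F + 1) x) :=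
  apply_eq_map_takeTup (hF a).1 ((ell_le_maxEll F a).trans (Nat.le_succ _)) x

/-- The predicate holds for all tuples of other lengths, so that a bound on the lengths may replace
the exact length. -/
theorem inCoNP_wordProblem (hn : 1 ≤ n) [Finite (Letter S)] (hF : IsTableChoice F) :
    InCoNP (wordProblem S) := by
  refine ⟨n, _, Polynomial.C (maxEll F) * Polynomial.X, hn,
    inP_of_takeTup (apply_eq_map_takeTup_maxEll hF) (maxEll F), Set.ext fun w => ?_⟩
  rw [wordProblem, Set.mem_ofPred_eq, wordVal_eq_one_iff hF]
  simp only [Set.mem_ofPred_eq, Polynomial.eval_mul, Polynomial.eval_C, Polynomial.eval_X]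
  exact ⟨fun h x _ => h x, fun h x hx => h x (fun i => (hx i).le) hx⟩

end Main

end BrinThompson

open BrinThompson
theorem mainTheorem3 (n : ℕ) (hn : 1 ≤ n) (S : Set (nV n)) (hfin : S.Finite)
    (hgen : Subgroup.closure S = ⊤) :
    InCoNP (wordProblem S) ∧
    ∀ F : Letter S → (Tup n ≃. Tup n), IsTableChoice F →
      (∀ w : List (Letter S),
        wordVal w = 1 ↔
          ∀ x : Tup n, (∀ i, (x i).length = maxEll F * w.length) → wordFun F w x = some x) ∧
      (∀ w v : List (Letter S), v <:+ w →
        ∀ x : Tup n, (∀ i, (x i).length = maxEll F * w.length) →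
          ∃ y, wordFun F v x = some y ∧ ∀ i, (y i).length ≤ 2 * maxEll F * w.length) ∧
      EvalInPolyTime F ∧
      InP (fun (x : Tup n) (w : List (Letter S)) =>
        (∀ i, (x i).length = maxEll F * w.length) → wordFun F w x = some x) := by
  have : Finite (Letter S) := finite_letter hfin
  obtain ⟨F₀, hF₀⟩ := exists_isTableChoice S
  refine ⟨inCoNP_wordProblem hn hF₀, fun F hF => ⟨wordVal_eq_one_iff hF, ?_,
    evalInPolyTime_of_takeTup (apply_eq_map_takeTup_maxEll hF),
    inP_of_takeTup (apply_eq_map_takeTup_maxEll hF) _⟩⟩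
  intro w v hvw x hx
  have hl : maxEll F * v.length ≤ maxEll F * w.length := Nat.mul_le_mul_left _ hvw.length_le
  obtain ⟨y, hy⟩ := exists_wordFun_eq hF v fun i => hl.trans (hx i).ge
  refine ⟨y, hy, fun i => ((length_wordFun_le hF v hy i).1.trans ?_)⟩
  rw [hx i, mul_assoc, two_mul]
  exact Nat.add_le_add_left hl _
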